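/- **Setting.** Let $d\ge 0$, let $\mathcal A$ be a finite set, let $(p_{ab})_{a,b\in\mathcal A}$ be a stochastic matrix with $p_{ab}>0$ for all $a,b$, and let $\pi$ be its stationary distribution. Let $\Lambda\subset\mathbb Z^d$ be finite, and for each $a\in\mathcal A$ let $q_{a,\cdot}$ be a probability distribution on $\Lambda$. At each site $u\in\mathbb Z^d$ let $(x_u^n)_{n\ge 0}$ be a Markov chain with transition matrix $p$ and initial distribution $\pi$, the chains at different sites being independent. Let $S_0=0$ and $S_{n+1}=S_n+v_n$, where, given the environment and $S_0,\dots,S_n$, one has $v_n=v$ with probability $q_{x^n_{S_n},v}$; let $\mathbb P$ be the law of the resulting Markov process $(x^n,S_n)_{n\ge 0}$. Put $\mathcal B=\{(a,v)\in\mathcal A\times\Lambda: q_{a,v}>0\}$, $\Omega^+=\mathcal B^{\{0,1,2,\dots\}}$, $\Omega=\mathcal B^{\mathbb Z}$, $\Omega^-=\mathcal B^{\{\dots,-1,0\}}$, with the shift $(\tau\omega)_i=\omega_{i+1}$. Let $\mathbb P^+$ be the law on $\Omega^+$ of the history $\omega_n=(x^n_{S_n},S_{n+1}-S_n)$, $n\ge0$,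 of the local environment seen from the particle; let $\mathbb E$ denote expectation with respect to $\mathbb P^+$, and let $\mathcal F_k$ be the $\sigma$-algebra on $\Omega^+$ generated by $\omega_0,\dots,\omega_k$. For a measure $\mu$ on $\Omega$ let $\mu^+,\mu^-$ be its marginals on $\Omega^+,\Omega^-$. **Gibbs measures.** For $\theta\in(0,1)$ let $d_\theta(\xi,\eta)=\theta^k$ for $\xi\ne\eta$ in $\Omega^+$, where $k$ is the largest index such that $\xi_i=\eta_i$ for $0\le i\le k$ ($k=-1$ if $\xi_0\neq\eta_0$), and $d_\theta(\xi,\xi)=0$. A function $\Omega^+\to\mathbb R$ is Hölder if it is $d_\theta$-Lipschitz for some $\theta\in(0,1)$. A shift-invariant probability measure $\nu$ on $\Omega^+$ is a Gibbs measure (with Hölder potential) if there is a Hölder function $\phi:\Omega^+\to\mathbb R$ such that, for every $b\in\mathcal B$, $e^{\phi(b,\omega_1,\omega_2,\dots)}$ is a version of the conditional probability $\nu(\omega_0=b\mid \omega_1,\omega_2,\dots)$. Gibbs measures on $\Omega^-$ are defined in the same way, with time reversed. A shift-invariant probability measure $\mu$ on $\Omega$ is called Gibbs if both $\mu^+$ and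 $\mu^-$ are Gibbs. **Lemma.** There exist a shift-invariant probability measure $\mu$ on $\Omega$ and $\gamma\in(0,1)$ such that for every $k\in\{0,1,2,\dots\}$ there is a constant $C_k$ such that for all $n,m\in\{0,1,2,\dots\}$ and every $\mathcal F_k$-measurable function $f:\Omega^+\to\mathbb R$, $$\bigl|\mathbb E(f\circ\tau^n\mid\mathcal F_m)-\mu(f)\bigr|\le C_k\,|f|_\infty\,\gamma^{\,n-m}\qquad \mathbb P^+\text{-almost surely},$$ where $\mu(f)=\int f\,d\mu^+$ and $|f|_\infty=\sup_{\Omega^+}|f|$. In addition, $\mu$ is a Gibbs measure. Finally, $\mathbb P^+$ is absolutely continuous with respect to $\mu^+$. -/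

import Mathlib

open MeasureTheory ProbabilityTheory

namespace LocalEnv

section Model

variable {d : ℕ} {A : Type*} [Finite A] [MeasurableSpace A] [MeasurableSingletonClass A]

/-- The sites `ℤ^d`. -/
abbrev Site (d : ℕ) : Type := Fin d → ℤ

/-- Joint state of the environment (an element of `A` at every site) and of the walker. -/
abbrev State (d : ℕ) (A : Type*) : Type _ := (Site d → A) × Site d

/-- The map sending a family of probability measures on `A`, selected by a field `x : Site d → A`,
to their infinite product depends measurably on the field. -/
lemma measurable_infinitePi_field (p : A → PMF A) :
    Measurable (fun x : Site d → A => Measure.infinitePi (fun u : Site d => (p (x u)).toMeasure)) := by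
  refine Measurable.measure_of_isPiSystem_of_isProbabilityMeasure
    (generateFrom_squareCylinders (α := fun _ : Site d => A)).symm
    (isPiSystem_squareCylinders (fun _ => MeasurableSpace.isPiSystem_measurableSet) (by simp)) ?_
  rintro _ ⟨s, t, ht, rfl⟩
  have ht' : ∀ i, MeasurableSet (t i) := fun i => ht i (Set.mem_univ i)
  have h : (fun x : Site d → A => Measure.infinitePi (fun u : Site d => (p (x u)).toMeasure)
      (Set.pi (s : Set (Site d)) t)) = fun x => ∏ u ∈ s, (p (x u)).toMeasure (t u) := by
    funext x
    exact Measure.infinitePi_pi _ (fun i _ => ht' i)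
  change Measurable (fun x : Site d → A => Measure.infinitePi
    (fun u : Site d => (p (x u)).toMeasure) (Set.pi (s : Set (Site d)) t))
  rw [h]
  exact Finset.measurable_prod s fun u _ =>
    (measurable_of_countable (fun a : A => (p a).toMeasure (t u))).comp (measurable_pi_apply u)

/-- One step of the environment: the sites evolve independently, the state `x u` at the site `u`
being replaced by a random state with law `p (x u)`. -/
noncomputable def envStep (p : A → PMF A) : Kernel (Site d → A) (Site d → A) where
  toFun x := Measure.infinitePi (fun u : Site d => (p (x u)).toMeasure)
  measurable' := measurable_infinitePi_field p

instance (p : A → PMF A) : IsMarkovKernel (envStep (d := d) p) :=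
  ⟨fun x => by
    change IsProbabilityMeasure (Measure.infinitePi (fun u : Site d => (p (x u)).toMeasure))
    infer_instance⟩

/-- The law of the next position depends measurably on the environment and the position. -/
lemma measurable_walkLaw {Λ : Finset (Site d)} (q : A → PMF Λ) :
    Measurable (fun z : State d A =>
      ((q (z.1 z.2)).map (fun v : Λ => z.2 + (v : Site d))).toMeasure) := by
  refine measurable_from_prod_countable_left fun s => ?_
  let g : A → Measure (Site d) := fun a => ((q a).map (fun v : Λ => s + (v : Site d))).toMeasure
  have hg : Measurable g := measurable_of_countable g
  exact hg.comp (measurable_pi_apply s)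

/-- One step of the walker: from `s` in the environment `x` it moves to `s + v`, where `v ∈ Λ` has
law `q (x s)`. -/
noncomputable def walkStep {Λ : Finset (Site d)} (q : A → PMF Λ) :
    Kernel (State d A) (Site d) where
  toFun z := ((q (z.1 z.2)).map (fun v : Λ => z.2 + (v : Site d))).toMeasure
  measurable' := measurable_walkLaw q

instance {Λ : Finset (Site d)} (q : A → PMF Λ) : IsMarkovKernel (walkStep q) :=
  ⟨fun z => PMF.toMeasure.isProbabilityMeasure
    ((q (z.1 z.2)).map (fun v : Λ => z.2 + (v : Site d)))⟩

/-- One step of the joint Markov process: given the present environment and position, the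
environment and the walker make their steps independently. -/
noncomputable def jointStep (p : A → PMF A) {Λ : Finset (Site d)} (q : A → PMF Λ) :
    Kernel (State d A) (State d A) :=
  ((envStep p).comap Prod.fst measurable_fst) ×ₖ (walkStep q)

instance (p : A → PMF A) {Λ : Finset (Site d)} (q : A → PMF Λ) :
    IsMarkovKernel (jointStep p q) := by
  unfold jointStep; infer_instance

/-- The law `ℙ` of the Markov process `(xⁿ, Sₙ)`, `n ≥ 0`, where the initial states at the sites
are independent with law `π` and the walk starts at `0`. -/
noncomputable def processLaw (p : A → PMF A) (π : PMF A) {Λ : Finset (Site d)} (q : A → PMF Λ) :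
    Measure (ℕ → State d A) :=
  Kernel.trajMeasure (X := fun _ => State d A)
    ((Measure.infinitePi (fun _ : Site d => π.toMeasure)).prod (Measure.dirac 0))
    (fun n => (jointStep p q).comap
      (fun h : (i : Finset.Iic n) → State d A => h ⟨n, Finset.mem_Iic.2 le_rfl⟩)
      (measurable_pi_apply _))

/-- The alphabet: pairs (state at the current site, jump) that have positive probability. -/
abbrev Alphabet {Λ : Finset (Site d)} (q : A → PMF Λ) : Type _ :=
  {b : A × Λ // 0 < q b.1 b.2}

/-- The history of the local environment along a trajectory: at time `n`, the state at the current
site of the walker and the jump `S (n + 1) - S n`. -/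
def localHistory (z : ℕ → State d A) : ℕ → A × Site d :=
  fun n => ((z n).1 (z n).2, (z (n + 1)).2 - (z n).2)

/-- The law `ℙ⁺` of the history on the space of sequences over the alphabet: a set `E` of such
sequences has the `ℙ`-probability that the history belongs to `E`. -/
noncomputable def historyLaw (p : A → PMF A) (π : PMF A) {Λ : Finset (Site d)} (q : A → PMF Λ) :
    Measure (ℕ → Alphabet q) :=
  ((processLaw p π q).map localHistory).comap
    (fun ω n => ((ω n).1.1, ((ω n).1.2 : Site d)))

end Model

section Sequences

variable {B : Type*}

/-- The shift on one-sided sequences. -/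
def shift (ω : ℕ → B) : ℕ → B := fun n => ω (n + 1)

/-- The shift on two-sided sequences. -/
def shiftZ (ω : ℤ → B) : ℤ → B := fun n => ω (n + 1)

/-- The `σ`-algebra generated by the coordinates `ω 0, …, ω k`. -/
@[reducible] def pastUpTo [MeasurableSpace B] (k : ℕ) : MeasurableSpace (ℕ → B) :=
  ⨆ i ∈ Finset.range (k + 1), MeasurableSpace.comap (fun ω : ℕ → B => ω i) inferInstance

open Classical in
/-- The distance `θ ^ k`, where `k` is the largest index such that the sequences agree up to `k`
(with `k = -1` if they differ at the index `0`). -/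
noncomputable def dTheta (θ : ℝ) (ξ η : ℕ → B) : ℝ :=
  if ξ = η then 0 else θ ^ ((PiNat.firstDiff (E := fun _ => B) ξ η : ℤ) - 1)

/-- `φ` is Lipschitz for one of the distances `dTheta θ`, `0 < θ < 1`. -/
def IsHolder (φ : (ℕ → B) → ℝ) : Prop :=
  ∃ θ ∈ Set.Ioo (0 : ℝ) 1, ∃ L : ℝ, ∀ ξ η, |φ ξ - φ η| ≤ L * dTheta θ ξ η

/-- The sequence `b, ω 0, ω 1, …`. -/
def cons (b : B) (ω : ℕ → B) : ℕ → B := fun n => Nat.casesOn n b ω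

/-- A shift-invariant probability measure on one-sided sequences (full shift) is Gibbs if the
logarithm of the conditional probability of the symbol at the index `0`, given all the other
symbols, is a Hölder function: for each `b`, `exp (φ (b, ω 1, ω 2, …))` is a version of the
conditional probability of `{ω 0 = b}` given `ω 1, ω 2, …`. -/
def IsGibbsOneSided [MeasurableSpace B] (ν : Measure (ℕ → B)) : Prop :=
  IsProbabilityMeasure ν ∧ MeasurePreserving shift ν ν ∧
    ∃ φ : (ℕ → B) → ℝ, IsHolder φ ∧ ∀ b : B,
      ν[Set.indicator {ω : ℕ → B | ω 0 = b} (fun _ => (1 : ℝ)) |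
        MeasurableSpace.comap shift inferInstance] =ᵐ[ν]
        fun ω => Real.exp (φ (cons b (shift ω)))

/-- The marginal `μ⁺` on the coordinates `0, 1, 2, …`. -/
noncomputable def plusMarginal [MeasurableSpace B] (μ : Measure (ℤ → B)) : Measure (ℕ → B) :=
  μ.map (fun ω (n : ℕ) => ω (n : ℤ))

/-- The marginal `μ⁻` on the coordinates `0, -1, -2, …`; a backward sequence is indexed by the
distance to the coordinate `0`. -/
noncomputable def minusMarginal [MeasurableSpace B] (μ : Measure (ℤ → B)) : Measure (ℕ → B) :=
  μ.map (fun ω (n : ℕ) => ω (-(n : ℤ)))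

/-- A measure on two-sided sequences is Gibbs if it is a shift-invariant probability measure both
of whose one-sided marginals are Gibbs: the conditional probability of a symbol given the whole
future, and the one given the whole past, have Hölder logarithms. -/
def IsGibbs [MeasurableSpace B] (μ : Measure (ℤ → B)) : Prop :=
  IsProbabilityMeasure μ ∧ MeasurePreserving shiftZ μ μ ∧
    IsGibbsOneSided (plusMarginal μ) ∧ IsGibbsOneSided (minusMarginal μ)

end Sequences

end LocalEnv

/-! The history is a chain whose memory fades exponentially. Given the letters seen so far, the
states at different sites are independent: an unvisited site still has law `π`, and a site last seen
in state `a` has the law of the chain `p` run from `a` since then (`map_restrict_historyEvent`).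
Hence the next letter `(a, v)` has conditional probability `letterProb`, the law of the current site
at `a` times `q a v`, and cylinder probabilities are products of these factors
(`historyLaw_cylinderSet`). Since `p > 0`, each step of `p` contracts total variation by `1 - c`, so
letters more than `k` steps old change this probability by at most `2 (1 - c) ^ k`; it is also
bounded below on the finite alphabet (`exists_holderKernel_letterProb`). The rest holds for every
such kernel `G`.

Mixing. Run the chain from two pasts, drawing the next letters with as much common mass as possible.
The number of recent letters in common grows by one or falls back to `0`, the latter with
probability at most `1 - c` and at most a constant times `θ ^ k` when `k` letters agree. Suitable
weights turn this into a one-step contraction (`exists_contracting_weights`), so iterates of the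
transfer operator converge exponentially to constants (`exists_transfer_limit`). Conditional
expectations given the past are such iterates (`condExp_history_add`), which gives the estimate; the
limits `P` of the word probabilities are the window probabilities of `μ`, obtained by compactness
(`exists_measure_of_tendsto`).

Gibbs property and absolute continuity. If the logarithmic ratio of two measures on cylinders has
geometrically small increments, it converges to a Hölder log-density (`exists_log_density`). The
stationary ratio `P (b :: w) / P w` is within `C * θ ^ w.length` of `G b w`, which compares the
history with `μ⁺` and gives the conditional probabilities given the past. Those given the future
need no new estimate: the increment to bound is a mixed second difference of `log P` in the first
and last letters of a word, and it is symmetric in the two. -/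

namespace LocalEnv

open Filter Topology

/-! ### Coupling inequality and contracting weights. -/

section Weights

/-- If `F` and `F'` are close along the diagonal, then so are their averages with respect to two
probability vectors, up to the mass the two vectors do not share. -/
lemma sum_mul_sub_sum_mul_le_coupling {B : Type*} [Fintype B] [Nonempty B] {g g' F F' : B → ℝ}
    {x y : ℝ} (hg : ∑ b, g b = 1) (hg' : ∑ b, g' b = 1) (hx : ∀ b, F b - F' b ≤ x)
    (hy : ∀ b b', F b - F' b' ≤ y) (hmin : ∀ b, 0 ≤ min (g b) (g' b)) :
    ∑ b, g b * F b - ∑ b, g' b * F' b ≤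
      (∑ b, min (g b) (g' b)) * x + (1 - ∑ b, min (g b) (g' b)) * y := by
  -- The unshared parts of `g` and `g'` have the same mass. Their contribution is largest with `F`
  -- at its maximum and `F'` at its minimum, a difference bounded by `y`.
  obtain ⟨b₁, hb₁⟩ := Finite.exists_max F
  obtain ⟨b₂, hb₂⟩ := Finite.exists_min F'
  have h1 : ∑ b, min (g b) (g' b) * (F b - F' b) ≤ (∑ b, min (g b) (g' b)) * x := by
    rw [Finset.sum_mul]
    exact Finset.sum_le_sum fun b _ => mul_le_mul_of_nonneg_left (hx b) (hmin b)
  have h2 : ∑ b, (g b - min (g b) (g' b)) * F b ≤ (1 - ∑ b, min (g b) (g' b)) * F b₁ := by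
    rw [← hg, ← Finset.sum_sub_distrib, Finset.sum_mul]
    exact Finset.sum_le_sum fun b _ =>
      mul_le_mul_of_nonneg_left (hb₁ b) (sub_nonneg.2 (min_le_left _ _))
  have h3 : (1 - ∑ b, min (g b) (g' b)) * F' b₂ ≤ ∑ b, (g' b - min (g b) (g' b)) * F' b := by
    rw [← hg', ← Finset.sum_sub_distrib, Finset.sum_mul]
    exact Finset.sum_le_sum fun b _ =>
      mul_le_mul_of_nonneg_left (hb₂ b) (sub_nonneg.2 (min_le_right _ _))
  have h4 : 0 ≤ 1 - ∑ b, min (g b) (g' b) := by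
    rw [← hg, ← Finset.sum_sub_distrib]
    exact Finset.sum_nonneg fun b _ => sub_nonneg.2 (min_le_left _ _)
  have h5 := mul_le_mul_of_nonneg_left (hy b₁ b₂) h4
  have h6 : ∑ b, g b * F b - ∑ b, g' b * F' b = ∑ b, min (g b) (g' b) * (F b - F' b)
      + ∑ b, (g b - min (g b) (g' b)) * F b - ∑ b, (g' b - min (g b) (g' b)) * F' b := by
    rw [← Finset.sum_sub_distrib, ← Finset.sum_add_distrib, ← Finset.sum_sub_distrib]
    exact Finset.sum_congr rfl fun b _ => by ring
  rw [h6]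
  linarith

/-- Weights for which the chain on `ℕ` that moves from `k` to `k + 1` or falls back to `0`
contracts in one step. -/
lemma exists_contracting_weights {c C θ : ℝ} (hc : 0 < c) (hc1 : c < 1) (hC : 0 < C) (hθ : 0 < θ)
    (hθ1 : θ < 1) :
    ∃ ρ : ℕ → ℝ, ∃ γ ∈ Set.Ioo (0 : ℝ) 1, Antitone ρ ∧ (∀ k, 0 < ρ k) ∧ ρ 0 ≤ 1 ∧
      ∀ k t, 0 ≤ t → t ≤ 1 - c → t ≤ C * θ ^ k →
        (1 - t) * ρ (k + 1) + t * ρ 0 ≤ γ * ρ k := by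
  -- From `K` on, falling back has probability at most `(1 - θ) / 4 * θ ^ (k - K)`, small enough to
  -- be absorbed by weights decaying like `θ ^ (k - K)`.
  obtain ⟨K, hK⟩ : ∃ K : ℕ, θ ^ K < (1 - θ) / (4 * C) :=
    exists_pow_lt_of_lt_one (by apply div_pos <;> linarith) hθ1
  have hK' : 2 * (C * θ ^ K) ≤ (1 - θ) / 2 := by
    rw [lt_div_iff₀ (by linarith)] at hK; linarith
  -- Below `K` only the success probability `c` is available. With `c * κ = 2`, a success gains `2 *
  -- ε * κ ^ k`, which pays for the loss `ε * κ ^ k` already present in `ρ k` and for the factor `1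
  -- - ε`.
  set κ : ℝ := 2 / c with hκ
  have hκ1 : 1 < κ := by rw [hκ, lt_div_iff₀ hc]; linarith
  have hcκ : c * κ = 2 := by rw [hκ]; field_simp
  have hκK : 0 < κ ^ K := by positivity
  set ε : ℝ := 1 / (2 * κ ^ K) with hε
  have hε0 : 0 < ε := by positivity
  have hεK : ε * κ ^ K = 1 / 2 := by rw [hε]; field_simp
  have hεk : ∀ k ≤ K, ε * κ ^ k ≤ 1 / 2 := fun k hk => by
    rw [← hεK]; gcongr; exact hκ1.le
  have hε1 : ε ≤ 1 / 2 := by simpa using hεk 0 (Nat.zero_le _)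
  -- The choice of `ε` gives `ε * κ ^ K = 1 / 2`, so the two formulas agree at `K`.
  set ρ : ℕ → ℝ := fun k => if k ≤ K then 1 - ε * κ ^ k else θ ^ (k - K) / 2 with hρ
  have hlow : ∀ k ≤ K, ρ k = 1 - ε * κ ^ k := fun k hk => by simp [hρ, hk]
  have hhigh : ∀ j, ρ (K + j) = θ ^ j / 2 := fun j => by
    rcases Nat.eq_zero_or_pos j with rfl | hj
    · rw [Nat.add_zero, hlow K le_rfl, hεK]; norm_num
    · simp [hρ, show ¬ (K + j ≤ K) by omega]
  have hpos : ∀ k, 0 < ρ k := fun k => by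
    rcases le_total k K with hk | hk
    · rw [hlow k hk]; linarith [hεk k hk]
    · obtain ⟨j, rfl⟩ := Nat.exists_eq_add_of_le hk
      rw [hhigh]; positivity
  have hanti : Antitone ρ := antitone_nat_of_succ_le fun k => by
    rcases lt_or_ge k K with hk | hk
    · rw [hlow k hk.le, hlow (k + 1) hk, pow_succ]
      have : 0 < ε * κ ^ k := by positivity
      nlinarith
    · obtain ⟨j, rfl⟩ := Nat.exists_eq_add_of_le hk
      rw [hhigh, add_assoc, hhigh, pow_succ]
      have : 0 < θ ^ j := by positivity
      nlinarith
  have h01 : ρ 0 ≤ 1 := by rw [hlow 0 (Nat.zero_le _)]; simp [hε0.le]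
  refine ⟨ρ, max ((1 + θ) / 2) (1 - ε), ⟨lt_max_of_lt_left (by linarith),
    max_lt (by linarith) (by linarith)⟩, hanti, hpos, h01, ?_⟩
  intro k t ht0 htc htC
  rcases lt_or_ge k K with hk | hk
  · have hmono : ρ (k + 1) ≤ ρ 0 := hanti (Nat.zero_le _)
    calc (1 - t) * ρ (k + 1) + t * ρ 0 ≤ c * ρ (k + 1) + (1 - c) * ρ 0 := by nlinarith
      _ ≤ c * ρ (k + 1) + (1 - c) * 1 := by
        have : 0 ≤ 1 - c := by linarith
        gcongr
      _ ≤ (1 - ε) * ρ k := by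
        rw [hlow k hk.le, hlow (k + 1) hk, pow_succ]
        have h1 : 0 < κ ^ k := by positivity
        have h2 : 1 ≤ κ ^ k := one_le_pow₀ hκ1.le
        have h3 : c * (1 - ε * (κ ^ k * κ)) = c - ε * κ ^ k * (c * κ) := by ring
        rw [h3, hcκ]
        nlinarith [mul_pos hε0 h1, mul_pos hε0 (mul_pos hε0 h1)]
      _ ≤ _ := mul_le_mul_of_nonneg_right (le_max_right _ _) (hpos k).le
  · obtain ⟨j, rfl⟩ := Nat.exists_eq_add_of_le hk
    have hj : 0 < θ ^ j := by positivity
    calc (1 - t) * ρ (K + j + 1) + t * ρ 0 ≤ 1 * ρ (K + j + 1) + C * θ ^ (K + j) * 1 := by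
          have := (hpos (K + j + 1)).le
          have := (hpos 0).le
          gcongr
          linarith
      _ ≤ (1 + θ) / 2 * ρ (K + j) := by
        rw [add_assoc, hhigh, hhigh, pow_succ, pow_add]
        nlinarith
      _ ≤ _ := mul_le_mul_of_nonneg_right (le_max_left _ _) (hpos _).le

end Weights

/-! ### Transfer operators of kernels with exponentially fading memory. -/

section HolderKernel

variable {B : Type*}

/-- The indicator of the words that begin with the word `w`. -/
noncomputable def wordIndicator (w x : List B) : ℝ :=
  open Classical in if x.take w.length = w then 1 else 0

lemma wordIndicator_nonneg (w u : List B) : 0 ≤ wordIndicator w u := by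
  unfold wordIndicator; split_ifs <;> simp

variable [Fintype B]

/-- A family of strictly positive transition probabilities `G b w` (the letter `b` comes after the
word `w`, whose most recent letter is first) that depends exponentially little on the distant
past. -/
structure HolderKernel (G : B → List B → ℝ) (c C θ : ℝ) : Prop where
  c_pos : 0 < c
  c_lt_one : c < 1
  C_pos : 0 < C
  θ_pos : 0 < θ
  θ_lt_one : θ < 1
  sum_eq_one : ∀ w, ∑ b, G b w = 1
  lower : ∀ b w, c ≤ G b w
  variation : ∀ k w w', w.take k = w'.take k → ∀ b, |G b w - G b w'| ≤ C * θ ^ k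

/-- The transfer operator: the expectation of `f` one step later. -/
def transfer (G : B → List B → ℝ) (f : List B → ℝ) (w : List B) : ℝ :=
  ∑ b, G b w * f (b :: w)

variable {G : B → List B → ℝ} {c C θ : ℝ}

lemma transfer_const_mul (a : ℝ) (f : List B → ℝ) :
    transfer G (fun w => a * f w) = fun w => a * transfer G f w := by
  funext w
  simp only [transfer, Finset.mul_sum]
  exact Finset.sum_congr rfl fun b _ => by ring

lemma transfer_iterate_const_mul (a : ℝ) (f : List B → ℝ) (n : ℕ) :
    (transfer G)^[n] (fun w => a * f w) = fun w => a * (transfer G)^[n] f w := by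
  induction n generalizing f with
  | zero => rfl
  | succ n ih => rw [Function.iterate_succ_apply, transfer_const_mul, ih]; rfl

namespace HolderKernel

lemma pos (hG : HolderKernel G c C θ) (b : B) (w : List B) : 0 < G b w :=
  hG.c_pos.trans_le (hG.lower b w)

lemma nonempty (hG : HolderKernel G c C θ) : Nonempty B := by
  by_contra h
  rw [not_nonempty_iff] at h
  simpa using hG.sum_eq_one []

lemma transfer_const (hG : HolderKernel G c C θ) (a : ℝ) :
    transfer G (fun _ => a) = fun _ => a := by
  funext w
  simp [transfer, ← Finset.sum_mul, hG.sum_eq_one]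

lemma transfer_mono (hG : HolderKernel G c C θ) {f g : List B → ℝ} (h : ∀ w, f w ≤ g w)
    (w : List B) : transfer G f w ≤ transfer G g w :=
  Finset.sum_le_sum fun b _ => mul_le_mul_of_nonneg_left (h _) (hG.pos b w).le

lemma transfer_iterate_mono (hG : HolderKernel G c C θ) {f g : List B → ℝ} (h : ∀ w, f w ≤ g w)
    (n : ℕ) (w : List B) : (transfer G)^[n] f w ≤ (transfer G)^[n] g w := by
  induction n generalizing f g with
  | zero => exact h w
  | succ n ih => exact ih (hG.transfer_mono h)

/-- One step of the coupling. Here `t` is the mass not shared by the laws of the next letter after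
`w` and after `w'`: with the shared mass the same letter is prepended and the agreement grows to `k
+ 1`, otherwise only the bound `R 0` remains. A single letter already shares mass `c`, and summing
the variation over the letters gives the bound in `θ ^ k`. -/
lemma transfer_sub_le (hG : HolderKernel G c C θ) {R : ℕ → ℝ}
    {f : List B → ℝ} (hf : ∀ k w w', w.take k = w'.take k → f w - f w' ≤ R k) {k : ℕ}
    {w w' : List B} (hw : w.take k = w'.take k) :
    ∃ t, 0 ≤ t ∧ t ≤ 1 - c ∧ t ≤ Fintype.card B * C * θ ^ k ∧
      transfer G f w - transfer G f w' ≤ (1 - t) * R (k + 1) + t * R 0 := by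
  have := hG.nonempty
  have hmin : ∀ b, c ≤ min (G b w) (G b w') := fun b => le_min (hG.lower b w) (hG.lower b w')
  have hsum : 1 - ∑ b, min (G b w) (G b w') = ∑ b, (G b w - min (G b w) (G b w')) := by
    rw [Finset.sum_sub_distrib, hG.sum_eq_one]
  refine ⟨1 - ∑ b, min (G b w) (G b w'), ?_, ?_, ?_, ?_⟩
  · rw [hsum]
    exact Finset.sum_nonneg fun b _ => sub_nonneg.2 (min_le_left _ _)
  · obtain ⟨b₀⟩ := hG.nonempty
    have := Finset.single_le_sum (f := fun b => min (G b w) (G b w'))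
      (fun b _ => hG.c_pos.le.trans (hmin b)) (Finset.mem_univ b₀)
    linarith [hmin b₀]
  · rw [hsum]
    refine (Finset.sum_le_card_nsmul _ _ (C * θ ^ k) fun b _ => ?_).trans_eq ?_
    · have h1 := hG.variation k w w' hw b
      have h2 : 0 ≤ C * θ ^ k := by have := hG.C_pos; have := hG.θ_pos; positivity
      rcases min_choice (G b w) (G b w') with h | h <;> rw [h]
      · simpa using h2
      · exact (le_abs_self _).trans h1
    · simp [mul_assoc]
  · rw [sub_sub_cancel]
    refine sum_mul_sub_sum_mul_le_coupling (hG.sum_eq_one w) (hG.sum_eq_one w') (fun b => ?_)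
      (fun b b' => hf 0 _ _ rfl) (fun b => hG.c_pos.le.trans (hmin b))
    exact hf (k + 1) _ _ (by simp [hw])

/-- Exponential convergence of the iterates of the transfer operator. -/
theorem exists_transfer_limit (hG : HolderKernel G c C θ) :
    ∃ γ ∈ Set.Ioo (0 : ℝ) 1, ∀ k : ℕ, ∃ D : ℝ, 0 ≤ D ∧ ∀ (f : List B → ℝ) (M : ℝ),
      (∀ w w', w.take k = w'.take k → f w = f w') → (∀ w, |f w| ≤ M) →
        ∃ l : ℝ, ∀ n w, |(transfer G)^[n] f w - l| ≤ D * M * γ ^ n := by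
  have := hG.nonempty
  obtain ⟨ρ, γ, hγ, hanti, hpos, h01, hρ⟩ := exists_contracting_weights hG.c_pos hG.c_lt_one
    (C := Fintype.card B * C) (by have := hG.C_pos; positivity) hG.θ_pos hG.θ_lt_one
  refine ⟨γ, hγ, fun k => ⟨2 / ρ k / (1 - γ), ?_, fun f M hf hM => ?_⟩⟩
  · have := hpos k
    have := hγ.2
    exact div_nonneg (by positivity) (by linarith)
  have hM0 : 0 ≤ M := (abs_nonneg _).trans (hM [])
  -- Scaled so that the trivial bound `2 * M` equals `H * ρ k`. At time `0` it is needed only for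
  -- words agreeing on `j ≤ k` letters, where `ρ k ≤ ρ j`; words agreeing on more have equal values
  -- of `f`.
  set H : ℝ := 2 * M / ρ k with hH
  have hH0 : 0 ≤ H := div_nonneg (by linarith) (hpos k).le
  have hosc : ∀ n j w w', w.take j = w'.take j →
      (transfer G)^[n] f w - (transfer G)^[n] f w' ≤ H * γ ^ n * ρ j := by
    intro n
    induction n with
    | zero =>
      intro j w w' hw
      rcases le_total k j with hkj | hjk
      · have : f w = f w' := hf w w' (by
          have := congrArg (List.take k) hw
          simpa [List.take_take, hkj] using this)
        simp only [Function.iterate_zero, id, this, sub_self]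
        have := (hpos j).le
        positivity
      · calc f w - f w' ≤ 2 * M := by
              linarith [(abs_le.1 (hM w)).2, (abs_le.1 (hM w')).1]
          _ = H * γ ^ 0 * ρ k := by
              have := (hpos k).ne'
              rw [hH]; field_simp
          _ ≤ _ := by
              have := hanti hjk
              gcongr
    | succ n ih =>
      intro j w w' hw
      have hc0 : 0 ≤ H * γ ^ n := mul_nonneg hH0 (pow_nonneg hγ.1.le _)
      obtain ⟨t, ht0, htc, htC, ht⟩ := hG.transfer_sub_le (R := fun j => H * γ ^ n * ρ j)
        ih hw
      rw [Function.iterate_succ_apply']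
      refine ht.trans ?_
      calc (1 - t) * (H * γ ^ n * ρ (j + 1)) + t * (H * γ ^ n * ρ 0)
          = H * γ ^ n * ((1 - t) * ρ (j + 1) + t * ρ 0) := by ring
        _ ≤ H * γ ^ n * (γ * ρ j) := mul_le_mul_of_nonneg_left (hρ j t ht0 htc htC) hc0
        _ = _ := by ring
  have hosc0 : ∀ n w w', |(transfer G)^[n] f w - (transfer G)^[n] f w'| ≤ H * γ ^ n := by
    intro n w w'
    have hc0 : 0 ≤ H * γ ^ n := mul_nonneg hH0 (pow_nonneg hγ.1.le _)
    rw [abs_le]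
    constructor
    · nlinarith [hosc n 0 w' w rfl]
    · nlinarith [hosc n 0 w w' rfl]
  have hstep : ∀ w n, dist ((transfer G)^[n] f w) ((transfer G)^[n + 1] f w) ≤ H * γ ^ n := by
    intro w n
    rw [Real.dist_eq, Function.iterate_succ_apply']
    -- The next iterate at `w` averages the present one over the words `b :: w`, so consecutive
    -- iterates differ by at most the oscillation over all words.
    have h1 : (transfer G)^[n] f w - transfer G ((transfer G)^[n] f) w
        = ∑ b, G b w * ((transfer G)^[n] f w - (transfer G)^[n] f (b :: w)) := by
      simp only [transfer, mul_sub, Finset.sum_sub_distrib, ← Finset.sum_mul, hG.sum_eq_one,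
        one_mul]
    rw [h1]
    calc _ ≤ ∑ b, |G b w * ((transfer G)^[n] f w - (transfer G)^[n] f (b :: w))| :=
          Finset.abs_sum_le_sum_abs _ _
      _ ≤ ∑ b, G b w * (H * γ ^ n) := Finset.sum_le_sum fun b _ => by
          rw [abs_mul, abs_of_pos (hG.pos b w)]
          exact mul_le_mul_of_nonneg_left (hosc0 n _ _) (hG.pos b w).le
      _ = _ := by rw [← Finset.sum_mul, hG.sum_eq_one, one_mul]
  have hconv : ∀ w, ∃ l, Tendsto (fun n => (transfer G)^[n] f w) atTop (𝓝 l) := fun w =>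
    cauchySeq_tendsto_of_complete (cauchySeq_of_le_geometric γ H hγ.2 (hstep w))
  obtain ⟨l, hl⟩ := hconv []
  refine ⟨l, fun n w => ?_⟩
  have hlw : Tendsto (fun n => (transfer G)^[n] f w) atTop (𝓝 l) := by
    -- The vanishing oscillation makes the limit independent of the past `w`.
    have h0 : Tendsto (fun n => (transfer G)^[n] f w - (transfer G)^[n] f []) atTop (𝓝 0) := by
      refine squeeze_zero_norm (a := fun n => H * γ ^ n) (fun n => hosc0 n _ _) ?_
      simpa using (tendsto_pow_atTop_nhds_zero_of_lt_one hγ.1.le hγ.2).const_mul H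
    simpa using h0.add hl
  have := dist_le_of_le_geometric_of_tendsto γ H hγ.2 (hstep w) hlw n
  rw [Real.dist_eq] at this
  refine this.trans_eq ?_
  rw [hH]; ring

/-- The stationary probabilities of words. -/
theorem exists_stationary (hG : HolderKernel G c C θ) :
    ∃ P : List B → ℝ, ∀ w u,
      Tendsto (fun n => (transfer G)^[n] (wordIndicator w) u) atTop (𝓝 (P w)) := by
  obtain ⟨γ, hγ, h⟩ := hG.exists_transfer_limit
  have : ∀ w : List B, ∃ l : ℝ, ∀ u,
      Tendsto (fun n => (transfer G)^[n] (wordIndicator w) u) atTop (𝓝 l) := by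
    intro w
    obtain ⟨D, -, hD⟩ := h w.length
    obtain ⟨l, hl⟩ := hD (wordIndicator w) 1 (fun x y hxy => by simp only [wordIndicator]; rw [hxy])
      (fun x => by unfold wordIndicator; split_ifs <;> simp)
    refine ⟨l, fun u => ?_⟩
    rw [tendsto_iff_norm_sub_tendsto_zero]
    refine squeeze_zero (fun n => norm_nonneg _) (fun n => hl n u) ?_
    simpa using (tendsto_pow_atTop_nhds_zero_of_lt_one hγ.1.le hγ.2).const_mul (D * 1)
  choose P hP using this
  exact ⟨P, hP⟩

section Stationary

variable {P : List B → ℝ}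

lemma transfer_wordIndicator_cons (b : B) (w u : List B) :
    transfer G (wordIndicator (b :: w)) u = G b u * wordIndicator w u := by
  classical
  simp only [transfer]
  rw [Finset.sum_eq_single b]
  · simp [wordIndicator]
  · intro b' _ hb
    simp [wordIndicator, hb]
  · simp

lemma stationary_nil (hG : HolderKernel G c C θ)
    (hP : ∀ w u, Tendsto (fun n => (transfer G)^[n] (wordIndicator w) u) atTop (𝓝 (P w))) :
    P [] = 1 := by
  have h1 : (wordIndicator [] : List B → ℝ) = fun _ => 1 := by funext u; simp [wordIndicator]
  refine tendsto_nhds_unique (hP [] []) ?_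
  have : ∀ n, (transfer G)^[n] (wordIndicator []) [] = 1 := fun n => by
    rw [h1, Function.iterate_fixed (hG.transfer_const 1)]
  simp [this]

/-- Since one application of the operator turns the indicator of `b :: w` into `G b` times the
indicator of `w`, `P (b :: w)` is the limit of the iterates of that product, and any bound on `G b`
over pasts beginning with `w` passes to the limit. -/
lemma stationary_cons_le (hG : HolderKernel G c C θ)
    (hP : ∀ w u, Tendsto (fun n => (transfer G)^[n] (wordIndicator w) u) atTop (𝓝 (P w)))
    {b : B} {w : List B} {a : ℝ} (ha : ∀ u, u.take w.length = w → G b u ≤ a) :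
    P (b :: w) ≤ a * P w := by
  refine le_of_tendsto_of_tendsto' ((hP (b :: w) []).comp (tendsto_add_atTop_nat 1))
    ((hP w []).const_mul a) fun n => ?_
  simp only [Function.comp, Function.iterate_succ_apply]
  have := congrFun (transfer_iterate_const_mul (G := G) a (wordIndicator w) n) []
  rw [← this]
  refine hG.transfer_iterate_mono (fun u => ?_) n []
  rw [transfer_wordIndicator_cons]
  by_cases hu : u.take w.length = w
  · exact mul_le_mul_of_nonneg_right (ha u hu) (wordIndicator_nonneg _ _)
  · simp [wordIndicator, hu]

lemma le_stationary_cons (hG : HolderKernel G c C θ)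
    (hP : ∀ w u, Tendsto (fun n => (transfer G)^[n] (wordIndicator w) u) atTop (𝓝 (P w)))
    {b : B} {w : List B} {a : ℝ} (ha : ∀ u, u.take w.length = w → a ≤ G b u) :
    a * P w ≤ P (b :: w) := by
  refine le_of_tendsto_of_tendsto' ((hP w []).const_mul a)
    ((hP (b :: w) []).comp (tendsto_add_atTop_nat 1)) fun n => ?_
  simp only [Function.comp, Function.iterate_succ_apply]
  have := congrFun (transfer_iterate_const_mul (G := G) a (wordIndicator w) n) []
  rw [← this]
  refine hG.transfer_iterate_mono (fun u => ?_) n []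
  rw [transfer_wordIndicator_cons]
  by_cases hu : u.take w.length = w
  · exact mul_le_mul_of_nonneg_right (ha u hu) (wordIndicator_nonneg _ _)
  · simp [wordIndicator, hu]

lemma stationary_pos (hG : HolderKernel G c C θ)
    (hP : ∀ w u, Tendsto (fun n => (transfer G)^[n] (wordIndicator w) u) atTop (𝓝 (P w)))
    (w : List B) : 0 < P w := by
  induction w with
  | nil => rw [hG.stationary_nil hP]; exact one_pos
  | cons b w ih =>
    exact (mul_pos hG.c_pos ih).trans_le (hG.le_stationary_cons hP fun u _ => hG.lower b u)

lemma abs_log_sub_log_le {a x y : ℝ} (ha : 0 < a) (hx : a ≤ x) (hy : a ≤ y) :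
    |Real.log x - Real.log y| ≤ |x - y| / a := by
  have key : ∀ x y : ℝ, a ≤ x → a ≤ y → Real.log x - Real.log y ≤ |x - y| / a := by
    intro x y hx hy
    have hx0 := ha.trans_le hx
    have hy0 := ha.trans_le hy
    rw [← Real.log_div hx0.ne' hy0.ne']
    calc Real.log (x / y) ≤ x / y - 1 := Real.log_le_sub_one_of_pos (by positivity)
      _ = (x - y) / y := by field_simp
      _ ≤ |x - y| / y := by gcongr; exact le_abs_self _
      _ ≤ |x - y| / a := by gcongr
  rw [abs_le]
  constructor
  · have := key y x hy hx
    rw [abs_sub_comm] at this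
    linarith
  · exact key x y hx hy

lemma abs_log_sub_log_variation (hG : HolderKernel G c C θ) {k : ℕ} {w w' : List B}
    (hw : w.take k = w'.take k) (b : B) :
    |Real.log (G b w) - Real.log (G b w')| ≤ C / c * θ ^ k := by
  refine (abs_log_sub_log_le hG.c_pos (hG.lower b w) (hG.lower b w')).trans ?_
  rw [div_mul_eq_mul_div]
  have := hG.c_pos
  gcongr
  exact hG.variation k w w' hw b

/-- The stationary conditional probability of a letter given a long word is close to the
transition probability. -/
lemma abs_log_stationary_cons (hG : HolderKernel G c C θ)
    (hP : ∀ w u, Tendsto (fun n => (transfer G)^[n] (wordIndicator w) u) atTop (𝓝 (P w)))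
    (b : B) (w : List B) :
    |Real.log (P (b :: w)) - Real.log (P w) - Real.log (G b w)| ≤ C / c * θ ^ w.length := by
  have hPw := hG.stationary_pos hP w
  have hPb := hG.stationary_pos hP (b :: w)
  rw [← Real.log_div hPb.ne' hPw.ne']
  -- `P (b :: w) / P w` is trapped between any bounds for `G b u` over pasts `u` beginning with `w`,
  -- and all these values are close to `G b w`.
  have hvar : ∀ u : List B, u.take w.length = w → |G b u - G b w| ≤ C * θ ^ w.length :=
    fun u hu => hG.variation _ _ _ (by simp [hu]) b
  refine (abs_log_sub_log_le hG.c_pos ?_ (hG.lower b w)).trans ?_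
  · rw [le_div_iff₀ hPw]
    exact hG.le_stationary_cons hP fun u _ => hG.lower b u
  · rw [div_mul_eq_mul_div]
    have := hG.c_pos
    gcongr
    rw [abs_le]
    constructor
    · have : (G b w - C * θ ^ w.length) ≤ P (b :: w) / P w := by
        rw [le_div_iff₀ hPw]
        exact hG.le_stationary_cons hP fun u hu => by linarith [(abs_le.1 (hvar u hu)).1]
      linarith
    · have : P (b :: w) / P w ≤ (G b w + C * θ ^ w.length) := by
        rw [div_le_iff₀ hPw]
        exact hG.stationary_cons_le hP fun u hu => by linarith [(abs_le.1 (hvar u hu)).2]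
      linarith

end Stationary

end HolderKernel

end HolderKernel

/-! ### Cylinders, indexed by words with the most recent letter first. -/

section History

variable {B : Type*}

/-- The word `ω (n - 1), …, ω 0`, the most recent letter first. -/
def history (ω : ℕ → B) : ℕ → List B
  | 0 => []
  | n + 1 => ω n :: history ω n

/-- The sequences whose first letters form the word `l`, read backwards. -/
def cylinderSet (l : List B) : Set (ℕ → B) := {ω | history ω l.length = l}

@[simp] lemma history_zero (ω : ℕ → B) : history ω 0 = [] := rfl

lemma history_succ (ω : ℕ → B) (n : ℕ) : history ω (n + 1) = ω n :: history ω n := rfl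

@[simp] lemma length_history (ω : ℕ → B) (n : ℕ) : (history ω n).length = n := by
  induction n with
  | zero => rfl
  | succ n ih => simp [history_succ, ih]

lemma history_succ_eq_append (ω : ℕ → B) (n : ℕ) :
    history ω (n + 1) = history (shift ω) n ++ [ω 0] := by
  induction n with
  | zero => rfl
  | succ n ih => rw [history_succ, ih, history_succ]; rfl

lemma history_eq_history_iff {ω ω' : ℕ → B} {n : ℕ} :
    history ω n = history ω' n ↔ ∀ i < n, ω i = ω' i := by
  induction n with
  | zero => simp
  | succ n ih =>
    rw [history_succ, history_succ, List.cons_eq_cons, ih]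
    constructor
    · rintro ⟨h, h'⟩ i hi
      rcases Nat.lt_succ_iff_lt_or_eq.1 hi with hi | rfl
      · exact h' i hi
      · exact h
    · exact fun h => ⟨h n (Nat.lt_succ_self n), fun i hi => h i (hi.trans (Nat.lt_succ_self n))⟩

lemma shift_iterate_apply (n k : ℕ) (ω : ℕ → B) : shift^[n] ω k = ω (n + k) := by
  induction n generalizing ω with
  | zero => simp
  | succ n ih =>
    rw [Function.iterate_succ_apply, ih]
    change ω _ = ω _
    congr 1; omega

lemma history_iterate_shift (ω : ℕ → B) (n k : ℕ) :
    history (shift^[n] ω) k = (history ω (n + k)).take k := by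
  induction k with
  | zero => simp
  | succ k ih =>
    rw [history_succ, ih, shift_iterate_apply, ← add_assoc, history_succ, List.take_succ_cons]

lemma history_reverse_flip {ω : ℕ → B} {ω' : ℕ → B} {n : ℕ} (h : ∀ i < n, ω' i = ω (n - 1 - i)) :
    history ω' n = (history ω n).reverse := by
  induction n generalizing ω with
  | zero => simp
  | succ n ih =>
    rw [history_succ_eq_append ω, List.reverse_append, List.reverse_singleton, history_succ,
      h n (Nat.lt_succ_self n), ← ih (ω := shift ω)]
    · simp
    · intro i hi
      rw [h i (hi.trans (Nat.lt_succ_self n))]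
      change ω _ = ω _
      congr 1; omega

lemma mem_cylinderSet {ω : ℕ → B} {l : List B} : ω ∈ cylinderSet l ↔ history ω l.length = l :=
  Iff.rfl

lemma cylinderSet_nil : cylinderSet ([] : List B) = Set.univ := by
  ext ω; simp [cylinderSet]

lemma cylinderSet_cons (b : B) (l : List B) :
    cylinderSet (b :: l) = cylinderSet l ∩ {ω | ω l.length = b} := by
  ext ω
  simp [cylinderSet, history_succ, and_comm]

lemma cylinderSet_append_singleton (b : B) (l : List B) :
    cylinderSet (l ++ [b]) = {ω | ω 0 = b} ∩ shift ⁻¹' cylinderSet l := by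
  ext ω
  simp only [cylinderSet, List.length_append, List.length_singleton, history_succ_eq_append,
    Set.mem_ofPred_eq, Set.mem_inter_iff, Set.mem_preimage]
  constructor
  · intro h
    exact ⟨by simpa using (List.append_inj' h rfl).2, (List.append_inj' h rfl).1⟩
  · rintro ⟨h, h'⟩
    rw [h, h']

lemma eq_of_mem_cylinderSet {ω : ℕ → B} {l l' : List B} (h : ω ∈ cylinderSet l)
    (h' : ω ∈ cylinderSet l') (hl : l.length = l'.length) : l = l' := by
  rw [mem_cylinderSet] at h h'
  rw [← h, hl, h']

lemma mem_cylinderSet_history (ω : ℕ → B) (n : ℕ) : ω ∈ cylinderSet (history ω n) := by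
  simp [cylinderSet]

lemma cylinderSet_subset {ω : ℕ → B} {l l' : List B} (h : ω ∈ cylinderSet l)
    (h' : ω ∈ cylinderSet l') (hl : l.length ≤ l'.length) : cylinderSet l' ⊆ cylinderSet l := by
  intro ξ hξ
  rw [mem_cylinderSet] at *
  refine Eq.trans ?_ h
  rw [history_eq_history_iff]
  intro i hi
  exact history_eq_history_iff.1 (hξ.trans h'.symm) i (hi.trans_le hl)

lemma exists_mem_cylinderSet [Nonempty B] (l : List B) : (cylinderSet l).Nonempty := by
  induction l with
  | nil => rw [cylinderSet_nil]; exact Set.univ_nonempty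
  | cons b l ih =>
    classical
    obtain ⟨ω, hω⟩ := ih
    refine ⟨Function.update ω l.length b, ?_⟩
    rw [cylinderSet_cons]
    refine ⟨?_, by simp⟩
    rw [mem_cylinderSet] at *
    conv_rhs => rw [← hω]
    rw [history_eq_history_iff]
    intro i hi
    simp [hi.ne]

lemma history_firstDiff (ξ η : ℕ → B) (n : ℕ)
    (hn : n ≤ PiNat.firstDiff (E := fun _ => B) ξ η) :
    history ξ n = history η n :=
  history_eq_history_iff.2 fun _ hi => PiNat.apply_eq_of_lt_firstDiff (E := fun _ => B)
    (hi.trans_le hn)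

section Measurability

lemma measurable_comp_history_of [Finite B] {γ : Type*} [MeasurableSpace γ] (f : List B → γ) (n : ℕ)
    {m : MeasurableSpace (ℕ → B)} (hm : ∀ i < n, ∀ b, MeasurableSet[m] {ω : ℕ → B | ω i = b}) :
    Measurable[m] (fun ω => f (history ω n)) := by
  have key : ∀ n, (∀ i < n, ∀ b, MeasurableSet[m] {ω : ℕ → B | ω i = b}) →
      ∀ l : List B, MeasurableSet[m] {ω : ℕ → B | history ω n = l} := by
    intro n
    induction n with
    | zero => intro _ l; simp
    | succ n ih =>
      intro h l
      cases l with
      | nil => simp [history_succ]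
      | cons b l =>
        have : {ω : ℕ → B | history ω (n + 1) = b :: l}
            = {ω | ω n = b} ∩ {ω | history ω n = l} := by
          ext ω; simp [history_succ]
        rw [this]
        exact (h n (Nat.lt_succ_self n) b).inter
          (ih (fun i hi => h i (hi.trans (Nat.lt_succ_self n))) l)
  let _ : MeasurableSpace (List B) := ⊤
  have h1 : Measurable[m] (fun ω : ℕ → B => history ω n) :=
    measurable_to_countable' (fun l => key n hm l)
  exact (measurable_from_top (f := f)).comp h1

variable [MeasurableSpace B]

lemma measurable_shift : Measurable (shift : (ℕ → B) → ℕ → B) :=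
  measurable_pi_lambda _ fun _ => measurable_pi_apply _

lemma pastUpTo_le (m : ℕ) : pastUpTo m ≤ (inferInstance : MeasurableSpace (ℕ → B)) :=
  iSup₂_le fun i _ => (measurable_pi_apply i).comap_le

/-- The history of length `m + 1` records the coordinates `0, …, m`, hence each generator of
`pastUpTo m` is a preimage under it. -/
lemma measurableSet_pastUpTo {m : ℕ} {s : Set (ℕ → B)} (hs : MeasurableSet[pastUpTo m] s) :
    ∃ S : Set (List B), s = {ω | history ω (m + 1) ∈ S} := by
  have : pastUpTo m ≤ MeasurableSpace.comap (fun ω : ℕ → B => history ω (m + 1)) ⊤ := by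
    refine iSup₂_le fun i hi => ?_
    rintro _ ⟨t, -, rfl⟩
    refine ⟨{l | ∃ ω : ℕ → B, history ω (m + 1) = l ∧ ω i ∈ t}, trivial, ?_⟩
    ext ω
    constructor
    · rintro ⟨ω', h, h'⟩
      rwa [history_eq_history_iff.1 h i (Finset.mem_range.1 hi)] at h'
    · exact fun h => ⟨ω, rfl, h⟩
  obtain ⟨S, -, rfl⟩ := this s hs
  exact ⟨S, rfl⟩

variable [MeasurableSingletonClass B]

lemma measurableSet_apply_eq (i : ℕ) (b : B) : MeasurableSet {ω : ℕ → B | ω i = b} :=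
  (measurable_pi_apply (X := fun _ : ℕ => B) i) (measurableSet_singleton b)

variable [Finite B]

lemma measurable_comp_history {γ : Type*} [MeasurableSpace γ] (f : List B → γ) (n : ℕ) :
    Measurable (fun ω => f (history ω n)) :=
  measurable_comp_history_of f n fun i _ b => measurableSet_apply_eq i b

lemma measurableSet_cylinderSet (l : List B) : MeasurableSet (cylinderSet l) := by
  have := measurable_comp_history (fun x => x = l) l.length
  exact measurableSet_setOfPred.2 this

lemma measurable_pastUpTo_comp_history {γ : Type*} [MeasurableSpace γ] (f : List B → γ) {n m : ℕ}
    (h : n ≤ m + 1) : Measurable[pastUpTo m] (fun ω => f (history ω n)) := by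
  refine measurable_comp_history_of f n fun i hi b => ?_
  have : MeasurableSpace.comap (fun ω : ℕ → B => ω i) inferInstance ≤ pastUpTo m :=
    le_iSup₂_of_le i (Finset.mem_range.2 (by omega)) le_rfl
  exact this _ ⟨{b}, measurableSet_singleton b, rfl⟩

lemma measure_cylinderSet_eq_sum [Fintype B] (ν : Measure (ℕ → B)) (l : List B) :
    ν (cylinderSet l) = ∑ b, ν (cylinderSet (b :: l)) := by
  rw [← measure_biUnion_finset]
  · congr 1
    ext ω
    simp [cylinderSet_cons]
  · intro b _ b' _ hb
    refine Set.disjoint_left.2 fun ω h h' => hb ?_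
    have := eq_of_mem_cylinderSet h h' (by simp)
    simpa using this
  · exact fun b _ => measurableSet_cylinderSet _

/-- Finite measures on one-sided sequences are determined by the measures of the cylinders. -/
theorem ext_of_cylinderSet {ν₁ ν₂ : Measure (ℕ → B)} [IsFiniteMeasure ν₁]
    (h : ∀ l, ν₁ (cylinderSet l) = ν₂ (cylinderSet l)) : ν₁ = ν₂ := by
  refine ext_of_generate_finite (Set.range (cylinderSet (B := B))) ?_ ?_ ?_ ?_
  · refine le_antisymm (iSup_le fun i => ?_) (MeasurableSpace.generateFrom_le ?_)
    · rintro _ ⟨t, -, rfl⟩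
      have : (fun ω : ℕ → B => ω i) ⁻¹' t
          = ⋃ l ∈ {l : List B | ∃ b ∈ t, ∃ l', l = b :: l' ∧ l'.length = i}, cylinderSet l := by
        ext ω
        simp only [Set.mem_preimage, Set.mem_iUnion, Set.mem_ofPred_eq, exists_prop]
        constructor
        · exact fun h => ⟨history ω (i + 1), ⟨ω i, h, history ω i, rfl, by simp⟩,
            mem_cylinderSet_history _ _⟩
        · rintro ⟨_, ⟨b, hb, l', rfl, rfl⟩, hω⟩
          rw [cylinderSet_cons] at hω
          rwa [hω.2]
      rw [this]
      exact MeasurableSet.biUnion (Set.to_countable _) fun l _ =>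
        MeasurableSpace.measurableSet_generateFrom ⟨l, rfl⟩
    · rintro _ ⟨l, rfl⟩
      exact measurableSet_cylinderSet l
  -- Two cylinders that meet are nested, so cylinders form a π-system.
  · rintro _ ⟨l, rfl⟩ _ ⟨l', rfl⟩ ⟨ω, h, h'⟩
    rcases le_total l.length l'.length with hl | hl
    · exact ⟨l', (Set.inter_eq_right.2 (cylinderSet_subset h h' hl)).symm⟩
    · exact ⟨l, (Set.inter_eq_left.2 (cylinderSet_subset h' h hl)).symm⟩
  · rintro _ ⟨l, rfl⟩
    exact h l
  · simpa [cylinderSet_nil] using h []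

end Measurability

end History

/-! ### Hölder densities from ratios of cylinder probabilities. -/

section Density

variable {B : Type*} [MeasurableSpace B] [MeasurableSingletonClass B]

/-- Cutting a cylinder into cylinders `j` letters longer replaces the error by that of the longer
words, which tends to `0`. -/
lemma measure_cylinderSet_le_of_asymptotic [Finite B] {α β : Measure (ℕ → B)} {ε : ℕ → ℝ}
    (hε : Tendsto ε atTop (𝓝 0))
    (h : ∀ l, α (cylinderSet l) ≤ ENNReal.ofReal (Real.exp (ε l.length)) * β (cylinderSet l))
    (l : List B) : α (cylinderSet l) ≤ β (cylinderSet l) := by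
  have := Fintype.ofFinite B
  have key : ∀ j l, α (cylinderSet l)
      ≤ ENNReal.ofReal (Real.exp (ε (j + l.length))) * β (cylinderSet l) := by
    intro j
    induction j with
    | zero => simpa using h
    | succ j ih =>
      intro l
      rw [measure_cylinderSet_eq_sum α, measure_cylinderSet_eq_sum β, Finset.mul_sum]
      refine Finset.sum_le_sum fun b _ => (ih (b :: l)).trans_eq ?_
      rw [List.length_cons]
      congr 4
      omega
  have hlim : Tendsto (fun j => ENNReal.ofReal (Real.exp (ε (j + l.length)))) atTop (𝓝 1) := by
    have h1 := (Real.continuous_exp.tendsto 0).comp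
      (hε.comp (tendsto_add_atTop_nat l.length))
    rw [Real.exp_zero] at h1
    simpa [Function.comp_def] using (ENNReal.continuous_ofReal.tendsto 1).comp h1
  have h2 := ENNReal.Tendsto.mul_const (b := β (cylinderSet l)) hlim (Or.inl one_ne_zero)
  rw [one_mul] at h2
  exact ge_of_tendsto' h2 fun j => key j l

/-- If the logarithms of the ratios of the cylinder probabilities of two measures have
exponentially small increments, then the first measure has a density with respect to the second
one, and the logarithm of this density is Hölder. -/
theorem exists_log_density [Finite B] {ν₁ ν₂ : Measure (ℕ → B)} [IsFiniteMeasure ν₁]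
    [IsFiniteMeasure ν₂]
    (h₁ : ∀ l, 0 < ν₁.real (cylinderSet l)) (h₂ : ∀ l, 0 < ν₂.real (cylinderSet l)) {K θ : ℝ}
    (hθ : 0 < θ) (hθ1 : θ < 1)
    (h : ∀ b l, |(Real.log (ν₁.real (cylinderSet (b :: l))) -
        Real.log (ν₂.real (cylinderSet (b :: l)))) -
      (Real.log (ν₁.real (cylinderSet l)) - Real.log (ν₂.real (cylinderSet l)))|
        ≤ K * θ ^ l.length) :
    ∃ φ : (ℕ → B) → ℝ, Measurable φ ∧
      (∀ n ω ω', history ω n = history ω' n → |φ ω - φ ω'| ≤ 2 * K / (1 - θ) * θ ^ n) ∧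
      ν₁ = ν₂.withDensity (fun ω => ENNReal.ofReal (Real.exp (φ ω))) := by
  -- Along each sequence the logarithmic ratios `ψ` form a Cauchy sequence at a geometric rate; the
  -- limit `φ` is the candidate log-density.
  set ψ : List B → ℝ := fun l =>
    Real.log (ν₁.real (cylinderSet l)) - Real.log (ν₂.real (cylinderSet l)) with hψ
  have hstep : ∀ ω n, dist (ψ (history ω n)) (ψ (history ω (n + 1))) ≤ K * θ ^ n := by
    intro ω n
    rw [dist_comm, Real.dist_eq, history_succ]
    simpa using h (ω n) (history ω n)
  have hconv : ∀ ω, ∃ x, Tendsto (fun n => ψ (history ω n)) atTop (𝓝 x) := fun ω =>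
    cauchySeq_tendsto_of_complete (cauchySeq_of_le_geometric θ K hθ1 (hstep ω))
  choose φ hφ using hconv
  have hdist : ∀ ω n, |ψ (history ω n) - φ ω| ≤ K / (1 - θ) * θ ^ n := by
    intro ω n
    have := dist_le_of_le_geometric_of_tendsto θ K hθ1 (hstep ω) (hφ ω) n
    rw [Real.dist_eq] at this
    exact this.trans_eq (by ring)
  have hmeas : Measurable φ :=
    measurable_of_tendsto_metrizable (fun n => measurable_comp_history ψ n)
      (tendsto_pi_nhds.2 hφ)
  refine ⟨φ, hmeas, fun n ω ω' hω => ?_, ?_⟩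
  · have h1 := hdist ω n
    have h2 := hdist ω' n
    rw [hω] at h1
    have h3 : |φ ω - φ ω'| ≤ |ψ (history ω' n) - φ ω'| + |ψ (history ω' n) - φ ω| := by
      rw [abs_sub_comm _ (φ ω), add_comm]
      exact abs_sub_le _ _ _
    refine h3.trans ((add_le_add h2 h1).trans_eq (by ring))
  set ν := ν₂.withDensity (fun ω => ENNReal.ofReal (Real.exp (φ ω))) with hν
  set ε : ℕ → ℝ := fun n => K / (1 - θ) * θ ^ n with hε
  have hε0 : Tendsto ε atTop (𝓝 0) := by
    simpa using (tendsto_pow_atTop_nhds_zero_of_lt_one hθ.le hθ1).const_mul (K / (1 - θ))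
  have hexp : ∀ l, ENNReal.ofReal (Real.exp (ψ l)) * ν₂ (cylinderSet l) = ν₁ (cylinderSet l) := by
    intro l
    rw [← ofReal_measureReal, ← ofReal_measureReal (μ := ν₁), ← ENNReal.ofReal_mul (by positivity),
      hψ, Real.exp_sub, Real.exp_log (h₁ l), Real.exp_log (h₂ l), div_mul_cancel₀ _ (h₂ l).ne']
  have hmemdist : ∀ l, ∀ ω ∈ cylinderSet l, |ψ l - φ ω| ≤ ε l.length := by
    intro l ω hω
    have := hdist ω l.length
    rwa [mem_cylinderSet.1 hω] at this
  have hle : ∀ l, ν (cylinderSet l)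
      ≤ ENNReal.ofReal (Real.exp (ε l.length)) * ν₁ (cylinderSet l) := by
    intro l
    rw [← hexp, ← mul_assoc, ← ENNReal.ofReal_mul (by positivity), ← Real.exp_add, hν,
      withDensity_apply _ (measurableSet_cylinderSet l), ← setLIntegral_const]
    refine setLIntegral_mono measurable_const fun ω hω => ?_
    have := abs_le.1 (hmemdist l ω hω)
    exact ENNReal.ofReal_le_ofReal (Real.exp_le_exp.2 (by linarith))
  have hge : ∀ l, ν₁ (cylinderSet l)
      ≤ ENNReal.ofReal (Real.exp (ε l.length)) * ν (cylinderSet l) := by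
    intro l
    rw [← hexp, hν, withDensity_apply _ (measurableSet_cylinderSet l), ← setLIntegral_const,
      ← lintegral_const_mul _ (by fun_prop)]
    refine setLIntegral_mono (by fun_prop) fun ω hω => ?_
    rw [← ENNReal.ofReal_mul (by positivity), ← Real.exp_add]
    have := abs_le.1 (hmemdist l ω hω)
    exact ENNReal.ofReal_le_ofReal (Real.exp_le_exp.2 (by linarith))
  exact ext_of_cylinderSet fun l => le_antisymm
    (measure_cylinderSet_le_of_asymptotic hε0 hge l)
    (measure_cylinderSet_le_of_asymptotic hε0 hle l)

/-- A shift-invariant probability measure is Gibbs if the logarithms of the conditional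
probabilities of the initial letter given the next `n` letters have exponentially small
increments. -/
theorem isGibbsOneSided_of_increments [Finite B] {ν : Measure (ℕ → B)} [IsProbabilityMeasure ν]
    (hν : MeasurePreserving shift ν ν) (hpos : ∀ l, 0 < ν.real (cylinderSet l)) {K θ : ℝ}
    (hθ : 0 < θ) (hθ1 : θ < 1)
    (h : ∀ b a l, |(Real.log (ν.real (cylinderSet (a :: l ++ [b]))) -
        Real.log (ν.real (cylinderSet (a :: l)))) -
      (Real.log (ν.real (cylinderSet (l ++ [b]))) - Real.log (ν.real (cylinderSet l)))|
        ≤ K * θ ^ l.length) :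
    IsGibbsOneSided ν := by
  refine ⟨inferInstance, hν, ?_⟩
  -- The density, with respect to `ν`, of the law of the shifted sequence on `{ω 0 = b}` is,
  -- evaluated at `shift ω`, the conditional probability sought. Words are read backwards, so `ω 0`
  -- is the last letter of `l ++ [b]` and the head of `a :: l` is the furthest future letter.
  have hmap : ∀ b l, ((ν.restrict {ω | ω 0 = b}).map shift) (cylinderSet l)
      = ν (cylinderSet (l ++ [b])) := by
    intro b l
    rw [Measure.map_apply measurable_shift (measurableSet_cylinderSet l),
      Measure.restrict_apply (measurable_shift (measurableSet_cylinderSet l)),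
      cylinderSet_append_singleton, Set.inter_comm]
  have hmapr : ∀ b l, ((ν.restrict {ω | ω 0 = b}).map shift).real (cylinderSet l)
      = ν.real (cylinderSet (l ++ [b])) := fun b l => by
    rw [measureReal_def, hmap, measureReal_def]
  have hdens : ∀ b, ∃ φ : (ℕ → B) → ℝ, Measurable φ ∧
      (∀ n ω ω', history ω n = history ω' n → |φ ω - φ ω'| ≤ 2 * K / (1 - θ) * θ ^ n) ∧
      (ν.restrict {ω | ω 0 = b}).map shift
        = ν.withDensity (fun ω => ENNReal.ofReal (Real.exp (φ ω))) := by
    intro b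
    refine exists_log_density (fun l => ?_) hpos hθ hθ1 fun a l => ?_
    · rw [hmapr]; exact hpos _
    · rw [hmapr, hmapr]; exact h b a l
  choose φ hφm hφ hφd using hdens
  refine ⟨fun ω => φ (ω 0) (shift ω), ⟨θ, ⟨hθ, hθ1⟩, ?_⟩, fun b => ?_⟩
  · obtain ⟨ω₀⟩ : Nonempty (ℕ → B) := nonempty_of_isProbabilityMeasure ν
    have : Nonempty B := ⟨ω₀ 0⟩
    obtain ⟨b₁, hb₁⟩ := Finite.exists_max fun b => |φ b ω₀|
    set D := 2 * K / (1 - θ) with hD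
    have hD0 : 0 ≤ D := by
      have := (abs_nonneg _).trans (hφ b₁ 0 ω₀ ω₀ rfl)
      simpa using this
    -- Sequences differing at the index `0` are at distance `θ⁻¹`, so the uniform bound on
    -- differences enters multiplied by `θ`. If the first difference is at `n + 1`, the distance is
    -- `θ ^ n` and the shifted sequences share exactly `n` initial letters, so `D` suffices.
    refine ⟨2 * (|φ b₁ ω₀| + D) * θ + D, fun ξ η => ?_⟩
    by_cases hξη : ξ = η
    · simp [hξη, dTheta]
    simp only [dTheta, hξη, if_false]
    rcases Nat.eq_zero_or_pos (PiNat.firstDiff (E := fun _ => B) ξ η) with h0 | h0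
    · rw [h0]
      have hb : ∀ ω : ℕ → B, |φ (ω 0) (shift ω)| ≤ |φ b₁ ω₀| + D := by
        intro ω
        have h1 := hφ (ω 0) 0 (shift ω) ω₀ rfl
        have h2 := abs_sub_abs_le_abs_sub (φ (ω 0) (shift ω)) (φ (ω 0) ω₀)
        have h3 := hb₁ (ω 0)
        simp only [pow_zero, mul_one] at h1
        linarith
      have h4 : |φ (ξ 0) (shift ξ) - φ (η 0) (shift η)| ≤ 2 * (|φ b₁ ω₀| + D) := by
        refine (abs_sub _ _).trans ?_
        linarith [hb ξ, hb η]
      refine h4.trans ?_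
      simp only [Nat.cast_zero, zero_sub, zpow_neg_one, add_mul]
      rw [mul_assoc (2 * _), mul_inv_cancel₀ hθ.ne', mul_one]
      have : 0 ≤ D * θ⁻¹ := by positivity
      linarith
    · obtain ⟨n, hn⟩ := Nat.exists_eq_succ_of_ne_zero h0.ne'
      have h1 := history_firstDiff ξ η (n + 1) (by omega)
      rw [history_succ_eq_append, history_succ_eq_append] at h1
      have h2 := List.append_inj' h1 rfl
      have h3 : ξ 0 = η 0 := by simpa using h2.2
      rw [h3]
      refine (hφ (η 0) n _ _ h2.1).trans ?_
      rw [hn]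
      have h5 : ((Nat.succ n : ℕ) : ℤ) - 1 = (n : ℤ) := by push_cast; ring
      rw [h5, zpow_natCast]
      have : 0 ≤ 2 * (|φ b₁ ω₀| + D) * θ := by positivity
      gcongr
      linarith
  · have hle : MeasurableSpace.comap shift inferInstance ≤
        (inferInstance : MeasurableSpace (ℕ → B)) := measurable_shift.comap_le
    have hcons : ∀ ω : ℕ → B, φ (cons b (shift ω) 0) (shift (cons b (shift ω))) = φ b (shift ω) :=
      fun ω => rfl
    simp only [hcons]
    have hint : Integrable (fun ω => Real.exp (φ b ω)) ν := by
      refine ⟨(by fun_prop : Measurable _).aestronglyMeasurable, ?_⟩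
      rw [hasFiniteIntegral_iff_ofReal (ae_of_all _ fun ω => (Real.exp_pos _).le)]
      have := congrArg (fun m => m Set.univ) (hφd b)
      simp only [withDensity_apply _ MeasurableSet.univ, Measure.restrict_univ] at this
      rw [← this]
      exact measure_lt_top _ _
    have hexpm : Measurable fun ω => Real.exp (φ b ω) := by fun_prop
    have hb : MeasurableSet {ω : ℕ → B | ω 0 = b} := measurableSet_apply_eq 0 b
    refine (ae_eq_condExp_of_forall_setIntegral_eq hle ((integrable_const _).indicator hb)
      (fun s _ _ => ?_) ?_ ?_).symm
    · exact ((hν.integrable_comp hexpm.aestronglyMeasurable).2 hint).integrableOn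
    · rintro _ ⟨t, ht, rfl⟩ -
      have h1 := setIntegral_map (μ := ν) (g := shift) ht
        (f := fun ω => Real.exp (φ b ω)) hexpm.aestronglyMeasurable measurable_shift.aemeasurable
      rw [hν.map_eq] at h1
      rw [← h1, integral_eq_lintegral_of_nonneg_ae (ae_of_all _ fun ω => (Real.exp_pos _).le)
        hexpm.aestronglyMeasurable, ← withDensity_apply _ ht, ← hφd b,
        Measure.map_apply measurable_shift ht, Measure.restrict_apply (measurable_shift ht),
        setIntegral_indicator hb]
      simp [measureReal_def]
    · exact (hexpm.comp (comap_measurable shift)).stronglyMeasurable.aestronglyMeasurable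

end Density

/-! ### Two-sided sequences and their one-sided windows. -/

section TwoSided

variable {B : Type*}

/-- The one-sided sequence of the coordinates `i, i + 1, …`. -/
def restrictFrom (i : ℤ) (ω : ℤ → B) : ℕ → B := fun n => ω (i + n)

lemma restrictFrom_add (i : ℤ) (n : ℕ) (ω : ℤ → B) :
    restrictFrom (i + n) ω = fun k => restrictFrom i ω (n + k) := by
  funext k
  simp [restrictFrom, add_assoc]

variable [MeasurableSpace B]

lemma measurable_restrictFrom (i : ℤ) : Measurable (restrictFrom i : (ℤ → B) → ℕ → B) :=
  measurable_pi_lambda _ fun _ => measurable_pi_apply _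

lemma measurable_shiftZ : Measurable (shiftZ : (ℤ → B) → ℤ → B) :=
  measurable_pi_lambda _ fun _ => measurable_pi_apply _

lemma plusMarginal_eq (μ : Measure (ℤ → B)) : plusMarginal μ = μ.map (restrictFrom 0) := by
  unfold plusMarginal
  congr 1
  funext ω n
  simp [restrictFrom]

/-- Finite measures on two-sided sequences are determined by the windows. -/
theorem ext_of_restrictFrom {μ₁ μ₂ : Measure (ℤ → B)} [IsFiniteMeasure μ₁]
    (h : ∀ i, μ₁.map (restrictFrom i) = μ₂.map (restrictFrom i)) : μ₁ = μ₂ := by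
  have hE : ∀ i E, MeasurableSet E →
      μ₁ (restrictFrom i ⁻¹' E) = μ₂ (restrictFrom i ⁻¹' E) := fun i E hE => by
    rw [← Measure.map_apply (measurable_restrictFrom i) hE, h,
      Measure.map_apply (measurable_restrictFrom i) hE]
  refine ext_of_generate_finite
    {s | ∃ (i : ℤ) (E : Set (ℕ → B)), MeasurableSet E ∧ s = restrictFrom i ⁻¹' E} ?_ ?_ ?_ ?_
  · refine le_antisymm (iSup_le fun i => ?_) (MeasurableSpace.generateFrom_le ?_)
    · rintro _ ⟨t, ht, rfl⟩
      refine MeasurableSpace.measurableSet_generateFrom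
        ⟨i, (fun ω => ω 0) ⁻¹' t, measurable_pi_apply 0 ht, ?_⟩
      have h0 : ∀ ω : ℤ → B, restrictFrom i ω 0 = ω i := fun ω => by simp [restrictFrom]
      ext ω
      change ω i ∈ t ↔ restrictFrom i ω 0 ∈ t
      rw [h0]
    · rintro _ ⟨i, E, hE, rfl⟩
      exact measurable_restrictFrom i hE
  · have key : ∀ (i : ℤ) (n : ℕ) (E E' : Set (ℕ → B)), MeasurableSet E → MeasurableSet E' →
        ∃ (j : ℤ) (F : Set (ℕ → B)), MeasurableSet F ∧
          restrictFrom i ⁻¹' E ∩ restrictFrom (i + n) ⁻¹' E' = restrictFrom j ⁻¹' F := by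
      intro i n E E' hE hE'
      have hm : Measurable (fun (ω : ℕ → B) (k : ℕ) => ω (n + k)) :=
        measurable_pi_lambda _ fun _ => measurable_pi_apply _
      refine ⟨i, E ∩ (fun (ω : ℕ → B) (k : ℕ) => ω (n + k)) ⁻¹' E', hE.inter (hm hE'), ?_⟩
      ext ω
      simp [restrictFrom_add]
    rintro _ ⟨i, E, hE, rfl⟩ _ ⟨i', E', hE', rfl⟩ -
    rcases le_total i i' with hi | hi
    · obtain ⟨n, rfl⟩ := Int.le.dest hi
      exact key i n E E' hE hE'
    · obtain ⟨n, rfl⟩ := Int.le.dest hi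
      rw [Set.inter_comm]
      exact key i' n E' E hE' hE
  · rintro _ ⟨i, E, hE', rfl⟩
    exact hE i E hE'
  · simpa using hE 0 Set.univ MeasurableSet.univ

end TwoSided

/-! ### Integrals of functions of finitely many letters. -/

section Words

variable {B : Type*} [Finite B]

variable (B) in
/-- The words of length `n`. -/
noncomputable def words (n : ℕ) : Finset (List B) := (List.finite_length_eq B n).toFinset

@[simp] lemma mem_words {n : ℕ} {l : List B} : l ∈ words B n ↔ l.length = n := by
  simp [words]

lemma exists_bound_comp_history (f : List B → ℝ) (n : ℕ) :
    ∃ M, ∀ ω : ℕ → B, |f (history ω n)| ≤ M := by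
  refine ⟨∑ l ∈ words B n, |f l|, fun ω => ?_⟩
  exact Finset.single_le_sum (f := fun l => |f l|) (fun l _ => abs_nonneg _)
    (mem_words.2 (length_history ω n))

variable [MeasurableSpace B] [MeasurableSingletonClass B]

lemma integrable_comp_history (ν : Measure (ℕ → B)) [IsFiniteMeasure ν] (f : List B → ℝ) (n : ℕ) :
    Integrable (fun ω => f (history ω n)) ν := by
  obtain ⟨M, hM⟩ := exists_bound_comp_history f n
  exact Integrable.of_bound (measurable_comp_history f n).aestronglyMeasurable M
    (ae_of_all _ fun ω => hM ω)

lemma setIntegral_history_mem (ν : Measure (ℕ → B)) [IsFiniteMeasure ν] (f : List B → ℝ)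
    (n k : ℕ) (S : Set (List B)) :
    ∫ ω in {ω | history ω n ∈ S}, f (history ω k) ∂ν =
      open Classical in
      ∑ l ∈ words B n with l ∈ S, ∫ ω in cylinderSet l, f (history ω k) ∂ν := by
  classical
  rw [← integral_biUnion_finset]
  · congr 2
    ext ω
    simp only [Set.mem_ofPred_eq, Set.mem_iUnion, Finset.mem_filter, mem_words, exists_prop]
    constructor
    · exact fun h => ⟨_, ⟨length_history ω n, h⟩, mem_cylinderSet_history _ _⟩
    · rintro ⟨l, ⟨rfl, h⟩, hω⟩
      rwa [mem_cylinderSet.1 hω]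
  · exact fun l _ => measurableSet_cylinderSet l
  · intro l hl l' hl' hne
    refine Set.disjoint_left.2 fun ω h h' => hne (eq_of_mem_cylinderSet h h' ?_)
    simp only [Finset.coe_filter, mem_words, Set.mem_ofPred_eq] at hl hl'
    rw [hl.1, hl'.1]
  · exact fun l _ => (integrable_comp_history ν f k).integrableOn

lemma setIntegral_cylinderSet (ν : Measure (ℕ → B)) (f : List B → ℝ) (l : List B) :
    ∫ ω in cylinderSet l, f (history ω l.length) ∂ν = f l * ν.real (cylinderSet l) := by
  rw [setIntegral_congr_fun (g := fun _ => f l) (measurableSet_cylinderSet l)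
    (fun ω hω => by simp only [mem_cylinderSet.1 hω]), setIntegral_const, smul_eq_mul, mul_comm]

lemma integral_comp_history (ν : Measure (ℕ → B)) [IsFiniteMeasure ν] (f : List B → ℝ) (n : ℕ) :
    ∫ ω, f (history ω n) ∂ν = ∑ l ∈ words B n, f l * ν.real (cylinderSet l) := by
  have := setIntegral_history_mem ν f n n Set.univ
  simp only [Set.mem_univ, Set.ofPred_true, Measure.restrict_univ, Finset.filter_true] at this
  rw [this]
  refine Finset.sum_congr rfl fun l hl => ?_
  rw [mem_words] at hl
  subst hl
  exact setIntegral_cylinderSet ν f l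

lemma setIntegral_cylinderSet_succ [Fintype B] (ν : Measure (ℕ → B)) [IsFiniteMeasure ν]
    (f : List B → ℝ) (l : List B) :
    ∫ ω in cylinderSet l, f (history ω (l.length + 1)) ∂ν =
      ∑ b, f (b :: l) * ν.real (cylinderSet (b :: l)) := by
  have : cylinderSet l = ⋃ b ∈ (Finset.univ : Finset B), cylinderSet (b :: l) := by
    ext ω
    simp [cylinderSet_cons]
  rw [this, integral_biUnion_finset]
  · exact Finset.sum_congr rfl fun b _ => setIntegral_cylinderSet ν f (b :: l)
  · exact fun l _ => measurableSet_cylinderSet _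
  · intro b _ b' _ hb
    refine Set.disjoint_left.2 fun ω h h' => hb ?_
    have := eq_of_mem_cylinderSet h h' (by simp)
    simpa using this
  · exact fun l _ => (integrable_comp_history ν f _).integrableOn

end Words

/-! ### Conditional expectations as iterates of the transfer operator. -/

section Chain

variable {B : Type*} [Fintype B] [MeasurableSpace B] [MeasurableSingletonClass B]
  {G : B → List B → ℝ} {c C θ : ℝ} {ν : Measure (ℕ → B)} [IsProbabilityMeasure ν]

lemma setIntegral_history_succ
    (hν : ∀ b l, ν.real (cylinderSet (b :: l)) = G b l * ν.real (cylinderSet l))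
    (f : List B → ℝ) (n : ℕ) (S : Set (List B)) :
    ∫ ω in {ω | history ω n ∈ S}, f (history ω (n + 1)) ∂ν =
      ∫ ω in {ω | history ω n ∈ S}, transfer G f (history ω n) ∂ν := by
  classical
  rw [setIntegral_history_mem, setIntegral_history_mem]
  refine Finset.sum_congr rfl fun l hl => ?_
  simp only [Finset.mem_filter, mem_words] at hl
  obtain ⟨rfl, -⟩ := hl
  rw [setIntegral_cylinderSet_succ, setIntegral_cylinderSet, transfer, Finset.sum_mul]
  refine Finset.sum_congr rfl fun b _ => ?_
  rw [hν]; ring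

lemma integral_history_eq_transfer
    (hν : ∀ b l, ν.real (cylinderSet (b :: l)) = G b l * ν.real (cylinderSet l))
    (f : List B → ℝ) (n : ℕ) :
    ∫ ω, f (history ω n) ∂ν = (transfer G)^[n] f [] := by
  induction n generalizing f with
  | zero => simp
  | succ n ih =>
    have := setIntegral_history_succ hν f n Set.univ
    simp only [Set.mem_univ, Set.ofPred_true, Measure.restrict_univ] at this
    rw [this, ih, Function.iterate_succ_apply]

lemma condExp_history_succ
    (hν : ∀ b l, ν.real (cylinderSet (b :: l)) = G b l * ν.real (cylinderSet l))
    (f : List B → ℝ) (m : ℕ) :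
    ν[fun ω => f (history ω (m + 2)) | pastUpTo m] =ᵐ[ν]
      fun ω => transfer G f (history ω (m + 1)) := by
  refine (ae_eq_condExp_of_forall_setIntegral_eq (pastUpTo_le m) (integrable_comp_history ν f _)
    (fun s _ _ => (integrable_comp_history ν _ _).integrableOn) (fun s hs _ => ?_) ?_).symm
  · obtain ⟨S, rfl⟩ := measurableSet_pastUpTo hs
    exact (setIntegral_history_succ hν f (m + 1) S).symm
  · exact (measurable_pastUpTo_comp_history _ le_rfl).stronglyMeasurable.aestronglyMeasurable

/-- Conditional expectations given the past are iterates of the transfer operator. -/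
theorem condExp_history_add
    (hν : ∀ b l, ν.real (cylinderSet (b :: l)) = G b l * ν.real (cylinderSet l))
    (f : List B → ℝ) (m j : ℕ) :
    ν[fun ω => f (history ω (m + 1 + j)) | pastUpTo m] =ᵐ[ν]
      fun ω => (transfer G)^[j] f (history ω (m + 1)) := by
  induction j generalizing f with
  | zero =>
    rw [condExp_of_stronglyMeasurable (pastUpTo_le m)
      (measurable_pastUpTo_comp_history f (by omega)).stronglyMeasurable
      (integrable_comp_history ν f _)]
    rfl
  | succ j ih =>
    have hle : pastUpTo m ≤ (pastUpTo (m + j) : MeasurableSpace (ℕ → B)) :=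
      biSup_mono fun i hi => by simp only [Finset.mem_range] at *; omega
    have h1 := condExp_condExp_of_le (μ := ν) (f := fun ω => f (history ω (m + j + 2))) hle
      (pastUpTo_le (m + j))
    have h2 := condExp_congr_ae (m := pastUpTo m) (condExp_history_succ hν f (m + j))
    have h3 := ih (transfer G f)
    rw [show m + 1 + (j + 1) = m + j + 2 by ring]
    rw [show m + 1 + j = m + j + 1 by ring] at h3
    exact (h1.symm.trans h2).trans h3

/-- The window at time `n` consists of the `w.length` most recent letters of the history of length
`n + w.length`, and the chain starts from the empty past. -/
lemma measureReal_shift_cylinderSet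
    (hν : ∀ b l, ν.real (cylinderSet (b :: l)) = G b l * ν.real (cylinderSet l))
    (w : List B) (n : ℕ) :
    ν.real (shift^[n] ⁻¹' cylinderSet w)
      = (transfer G)^[n + w.length] (wordIndicator w) [] := by
  rw [← integral_history_eq_transfer hν, ← integral_indicator_one]
  · refine integral_congr_ae (ae_of_all _ fun ω => ?_)
    have hmem : ω ∈ shift^[n] ⁻¹' cylinderSet w
        ↔ (history ω (n + w.length)).take w.length = w := by
      rw [Set.mem_preimage, mem_cylinderSet, history_iterate_shift]
    by_cases hω : (history ω (n + w.length)).take w.length = w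
    · simp [wordIndicator, hω, Set.indicator_of_mem (hmem.2 hω)]
    · simp [wordIndicator, hω, Set.indicator_of_notMem (fun h => hω (hmem.1 h))]
  · exact measurable_shift.iterate n (measurableSet_cylinderSet w)

lemma tendsto_measureReal_shift_cylinderSet
    (hν : ∀ b l, ν.real (cylinderSet (b :: l)) = G b l * ν.real (cylinderSet l))
    {P : List B → ℝ}
    (hP : ∀ w u, Tendsto (fun n => (transfer G)^[n] (wordIndicator w) u) atTop (𝓝 (P w)))
    (w : List B) :
    Tendsto (fun n => ν.real (shift^[n] ⁻¹' cylinderSet w)) atTop (𝓝 (P w)) := by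
  simp only [measureReal_shift_cylinderSet hν]
  exact (hP w []).comp (tendsto_add_atTop_nat w.length)

end Chain

/-! ### The two-sided stationary measure by compactness. -/

section Limit

variable {B : Type*} [Finite B] [MeasurableSpace B] [MeasurableSingletonClass B]

/-- If the probabilities of the words at time `n` converge, then the limits are the probabilities
of the windows for a measure on two-sided sequences. -/
theorem exists_measure_of_tendsto {ν : Measure (ℕ → B)} [IsProbabilityMeasure ν] {P : List B → ℝ}
    (h : ∀ w, Tendsto (fun n => ν.real (shift^[n] ⁻¹' cylinderSet w)) atTop (𝓝 (P w))) :
    ∃ μ : Measure (ℤ → B), IsProbabilityMeasure μ ∧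
      ∀ i w, (μ.map (restrictFrom i)).real (cylinderSet w) = P w := by
  let _ : TopologicalSpace B := ⊥
  have : DiscreteTopology B := ⟨rfl⟩
  have : BorelSpace B := ⟨by
    rw [borel_eq_top_of_discrete]
    exact eq_top_iff.2 fun s _ => (Set.toFinite s).measurableSet⟩
  -- Time `n` becomes the origin. The values at coordinates below `-n` are arbitrary; each fixed
  -- window avoids them once `n` is large.
  let e : ℕ → (ℕ → B) → ℤ → B := fun n ω i => ω (i + n).toNat
  have he : ∀ n, Measurable (e n) := fun n =>
    measurable_pi_lambda _ fun _ => measurable_pi_apply _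
  let M : ℕ → ProbabilityMeasure (ℤ → B) := fun n =>
    ⟨ν.map (e n), Measure.isProbabilityMeasure_map (he n).aemeasurable⟩
  -- Probability measures on the compact space of two-sided sequences form a compact space, so the
  -- recentred laws converge along a nonprincipal ultrafilter. Cylinders are clopen, hence their
  -- probabilities converge too.
  obtain ⟨μ, -, hμ⟩ := isCompact_univ.ultrafilter_le_nhds ((hyperfilter ℕ).map M) (by simp)
  have hlim : Tendsto M (hyperfilter ℕ) (𝓝 μ) := hμ
  refine ⟨μ, inferInstance, fun i w => ?_⟩
  have hms := measurable_restrictFrom (B := B) i (measurableSet_cylinderSet w)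
  rw [map_measureReal_apply (measurable_restrictFrom i) (measurableSet_cylinderSet w)]
  have hclopen : IsClopen (restrictFrom i ⁻¹' cylinderSet w : Set (ℤ → B)) := by
    have h1 : ∀ l : List B, IsClopen (cylinderSet l) := by
      intro l
      induction l with
      | nil => rw [cylinderSet_nil]; exact isClopen_univ
      | cons b l ih =>
        rw [cylinderSet_cons]
        exact ih.inter ((isClopen_discrete {b}).preimage (continuous_apply l.length))
    exact (h1 w).preimage (continuous_pi fun _ => continuous_apply _)
  have h2 := ProbabilityMeasure.tendsto_measure_of_null_frontier_of_tendsto' hlim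
    (E := restrictFrom i ⁻¹' cylinderSet w) (by rw [hclopen.frontier_eq]; simp)
  have h3 := (ENNReal.tendsto_toReal (measure_ne_top _ _)).comp h2
  have h4 : Tendsto (fun n : ℕ => ν.real (shift^[(i + n).toNat] ⁻¹' cylinderSet w)) (hyperfilter ℕ)
      (𝓝 (P w)) := by
    refine ((h w).comp ?_).mono_left Nat.hyperfilter_le_atTop
    refine tendsto_atTop.2 fun k => ?_
    filter_upwards [eventually_ge_atTop (k + i.natAbs)] with n hn
    omega
  refine tendsto_nhds_unique h3 (h4.congr' ?_)
  refine Eventually.filter_mono Nat.hyperfilter_le_atTop ?_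
  filter_upwards [eventually_ge_atTop i.natAbs] with n hn
  change _ = (Measure.map (e n) ν _).toReal
  rw [Measure.map_apply (he n) hms, measureReal_def]
  congr 2
  ext ω
  simp only [Set.mem_preimage]
  have : restrictFrom i (e n ω) = shift^[(i + n).toNat] ω := by
    funext k
    rw [shift_iterate_apply]
    change ω _ = ω _
    congr 1; omega
  rw [this]

end Limit

/-! ### Stationarity and the forward and backward marginals. -/

section Marginals

variable {B : Type*} [MeasurableSpace B] {μ : Measure (ℤ → B)} {P : List B → ℝ}

lemma measurable_minus : Measurable (fun (ω : ℤ → B) (n : ℕ) => ω (-(n : ℤ))) :=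
  measurable_pi_lambda _ fun _ => measurable_pi_apply _

lemma measureReal_plusMarginal
    (hμ : ∀ i w, (μ.map (restrictFrom i)).real (cylinderSet w) = P w) (w : List B) :
    (plusMarginal μ).real (cylinderSet w) = P w := by
  rw [plusMarginal_eq, hμ]

lemma measurePreserving_shift_plusMarginal (hμ : MeasurePreserving shiftZ μ μ) :
    MeasurePreserving shift (plusMarginal μ) (plusMarginal μ) := by
  refine ⟨measurable_shift, ?_⟩
  have hcomp : shift ∘ (restrictFrom 0 : (ℤ → B) → ℕ → B) = restrictFrom 0 ∘ shiftZ := by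
    funext ω n
    change ω _ = ω _
    congr 1
  rw [plusMarginal_eq, Measure.map_map measurable_shift (measurable_restrictFrom 0), hcomp,
    ← Measure.map_map (measurable_restrictFrom 0) measurable_shiftZ, hμ.map_eq]

lemma measurePreserving_shift_minusMarginal (hμ : MeasurePreserving shiftZ μ μ) :
    MeasurePreserving shift (minusMarginal μ) (minusMarginal μ) := by
  refine ⟨measurable_shift, ?_⟩
  have hcomp : (shift ∘ fun (ω : ℤ → B) (n : ℕ) => ω (-(n : ℤ))) ∘ shiftZ
      = fun (ω : ℤ → B) (n : ℕ) => ω (-(n : ℤ)) := by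
    funext ω n
    change ω _ = ω _
    congr 1; push_cast; ring
  rw [minusMarginal, Measure.map_map measurable_shift measurable_minus]
  conv_lhs => rw [← hμ.map_eq]
  rw [Measure.map_map (measurable_shift.comp measurable_minus) measurable_shiftZ, hcomp]

variable [Finite B] [MeasurableSingletonClass B]

/-- The first `w.length` backward coordinates occupy the window from `1 - w.length` to `0`,
traversed in the opposite direction; hence the reversal. -/
lemma measureReal_minusMarginal
    (hμ : ∀ i w, (μ.map (restrictFrom i)).real (cylinderSet w) = P w) (w : List B) :
    (minusMarginal μ).real (cylinderSet w) = P w.reverse := by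
  rw [minusMarginal, map_measureReal_apply measurable_minus (measurableSet_cylinderSet w),
    ← hμ (1 - w.length), map_measureReal_apply (measurable_restrictFrom _)
      (measurableSet_cylinderSet _)]
  congr 1
  ext ω
  simp only [Set.mem_preimage, mem_cylinderSet, List.length_reverse]
  rw [history_reverse_flip (ω := restrictFrom (1 - w.length) ω) (n := w.length),
    List.reverse_eq_iff]
  intro i hi
  unfold restrictFrom
  congr 1
  omega

lemma measurePreserving_shiftZ [IsProbabilityMeasure μ]
    (hμ : ∀ i w, (μ.map (restrictFrom i)).real (cylinderSet w) = P w) :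
    MeasurePreserving shiftZ μ μ := by
  refine ⟨measurable_shiftZ, ?_⟩
  have := Measure.isProbabilityMeasure_map (μ := μ) measurable_shiftZ.aemeasurable
  refine ext_of_restrictFrom fun i => ?_
  have hp : ∀ i, IsProbabilityMeasure (μ.map (restrictFrom i)) := fun i =>
    Measure.isProbabilityMeasure_map (measurable_restrictFrom i).aemeasurable
  have hcomp : (restrictFrom i : (ℤ → B) → ℕ → B) ∘ shiftZ = restrictFrom (i + 1) := by
    funext ω n
    change ω _ = ω _
    congr 1
    ring
  rw [Measure.map_map (measurable_restrictFrom i) measurable_shiftZ, hcomp]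
  refine ext_of_cylinderSet fun l => ?_
  rw [← measureReal_eq_measureReal_iff, hμ, hμ]

end Marginals

/-! ### Gibbs property, absolute continuity and exponential mixing. -/

section Gibbs

lemma apply_eq_of_measurable_pastUpTo {B : Type*} [MeasurableSpace B] {k : ℕ} {f : (ℕ → B) → ℝ} (hf : Measurable[pastUpTo k] f)
    {ω ω' : ℕ → B} (h : history ω (k + 1) = history ω' (k + 1)) : f ω = f ω' := by
  obtain ⟨S, hS⟩ := measurableSet_pastUpTo (hf (measurableSet_singleton (f ω')))
  have h1 : ω' ∈ f ⁻¹' {f ω'} := rfl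
  have h2 : ω ∈ f ⁻¹' {f ω'} := by
    rw [hS] at h1 ⊢
    rw [Set.mem_ofPred_eq, h]
    exact h1
  exact h2

variable {B : Type*} [Fintype B] {G : B → List B → ℝ} {c C θ : ℝ}

/-- Each stationary ratio is replaced by `G` at the cost of one error, and the two values of `G`
differ by a third; hence the factor `3`. -/
lemma HolderKernel.abs_log_stationary_increment (hG : HolderKernel G c C θ) {P : List B → ℝ}
    (hP : ∀ w u, Tendsto (fun n => (transfer G)^[n] (wordIndicator w) u) atTop (𝓝 (P w)))
    (b : B) {w w' : List B} {k : ℕ} (hw : w.take k = w'.take k) (hk : k ≤ w.length)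
    (hk' : k ≤ w'.length) :
    |(Real.log (P (b :: w)) - Real.log (P w)) - (Real.log (P (b :: w')) - Real.log (P w'))|
      ≤ 3 * (C / c) * θ ^ k := by
  have hCc : 0 ≤ C / c := (div_pos hG.C_pos hG.c_pos).le
  have h1 := (hG.abs_log_stationary_cons hP b w).trans
    (mul_le_mul_of_nonneg_left (pow_le_pow_of_le_one hG.θ_pos.le hG.θ_lt_one.le hk) hCc)
  have h2 := (hG.abs_log_stationary_cons hP b w').trans
    (mul_le_mul_of_nonneg_left (pow_le_pow_of_le_one hG.θ_pos.le hG.θ_lt_one.le hk') hCc)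
  have h3 := hG.abs_log_sub_log_variation hw b
  rw [abs_le] at *
  constructor <;> linarith [h1.1, h1.2, h2.1, h2.2, h3.1, h3.2]

variable [MeasurableSpace B] [MeasurableSingletonClass B]

/-- The two-sided stationary measure of a chain with a Hölder kernel is Gibbs. -/
theorem HolderKernel.isGibbs (hG : HolderKernel G c C θ) {P : List B → ℝ}
    (hP : ∀ w u, Tendsto (fun n => (transfer G)^[n] (wordIndicator w) u) atTop (𝓝 (P w)))
    {μ : Measure (ℤ → B)} [IsProbabilityMeasure μ]
    (hμ : ∀ i w, (μ.map (restrictFrom i)).real (cylinderSet w) = P w) :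
    IsGibbs μ := by
  have hshift := measurePreserving_shiftZ hμ
  have hplus : IsProbabilityMeasure (plusMarginal μ) := by
    rw [plusMarginal_eq]
    exact Measure.isProbabilityMeasure_map (measurable_restrictFrom 0).aemeasurable
  have hminus : IsProbabilityMeasure (minusMarginal μ) :=
    Measure.isProbabilityMeasure_map measurable_minus.aemeasurable
  refine ⟨inferInstance, hshift, ?_, ?_⟩
  · refine isGibbsOneSided_of_increments (measurePreserving_shift_plusMarginal hshift)
      (K := 3 * (C / c)) (fun l => ?_) hG.θ_pos hG.θ_lt_one fun b a l => ?_
    · rw [measureReal_plusMarginal hμ]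
      exact hG.stationary_pos hP l
    · simp only [measureReal_plusMarginal hμ]
      -- The increment in the far future letter `a` of the log-probability of `b` equals the
      -- increment in the oldest letter `b` of the log-probability of `a`. The latter concerns
      -- prediction from the pasts `l ++ [b]` and `l`, which share their `l.length` most recent
      -- letters.
      have := hG.abs_log_stationary_increment hP a (w := l ++ [b]) (w' := l) (k := l.length)
        (by simp) (by simp) le_rfl
      refine le_trans (le_of_eq ?_) this
      rw [List.cons_append]
      congr 1
      ring
  · refine isGibbsOneSided_of_increments (measurePreserving_shift_minusMarginal hshift)
      (K := 3 * (C / c)) (fun l => ?_) hG.θ_pos hG.θ_lt_one fun b a l => ?_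
    · rw [measureReal_minusMarginal hμ]
      exact hG.stationary_pos hP _
    · simp only [measureReal_minusMarginal hμ, List.reverse_append, List.reverse_cons,
        List.reverse_nil, List.nil_append, List.singleton_append]
      have := hG.abs_log_stationary_increment hP b (w := l.reverse ++ [a]) (w' := l.reverse)
        (k := l.length) (by simp) (by simp) (by simp)
      simpa using this

/-- A chain with a Hölder kernel started from a fixed past is absolutely continuous with respect
to the stationary chain. -/
theorem HolderKernel.absolutelyContinuous (hG : HolderKernel G c C θ) {P : List B → ℝ}
    (hP : ∀ w u, Tendsto (fun n => (transfer G)^[n] (wordIndicator w) u) atTop (𝓝 (P w)))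
    {ν ξ : Measure (ℕ → B)} [IsProbabilityMeasure ν] [IsProbabilityMeasure ξ]
    (hν : ∀ b l, ν.real (cylinderSet (b :: l)) = G b l * ν.real (cylinderSet l))
    (hξ : ∀ w, ξ.real (cylinderSet w) = P w) : ν ≪ ξ := by
  have hpos : ∀ l, 0 < ν.real (cylinderSet l) := by
    intro l
    induction l with
    | nil => simp [cylinderSet_nil]
    | cons b l ih => rw [hν]; exact mul_pos (hG.pos b l) ih
  obtain ⟨φ, -, -, h⟩ := exists_log_density (ν₁ := ν) (ν₂ := ξ) (K := C / c) hpos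
    (fun l => by rw [hξ]; exact hG.stationary_pos hP l) hG.θ_pos hG.θ_lt_one fun b l => by
      rw [hν, hξ, hξ, Real.log_mul (hG.pos b l).ne' (hpos l).ne']
      have := hG.abs_log_stationary_cons hP b l
      rw [abs_sub_comm] at this
      refine le_trans (le_of_eq ?_) this
      congr 1
      ring
  rw [h]
  exact withDensity_absolutelyContinuous _ _

/-- Existence of a Gibbs measure to which a chain with a Hölder kernel converges exponentially
fast. -/
theorem HolderKernel.exists_isGibbs (hG : HolderKernel G c C θ) (ν : Measure (ℕ → B))
    [IsProbabilityMeasure ν]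
    (hν : ∀ b l, ν.real (cylinderSet (b :: l)) = G b l * ν.real (cylinderSet l)) :
    ∃ μ : Measure (ℤ → B),
      IsProbabilityMeasure μ ∧ MeasurePreserving shiftZ μ μ ∧
      (∃ γ ∈ Set.Ioo (0 : ℝ) 1, ∀ k : ℕ, ∃ D : ℝ, ∀ n m : ℕ,
        ∀ f : (ℕ → B) → ℝ, Measurable[pastUpTo k] f →
          ∀ᵐ ω ∂ν,
            |(ν[f ∘ shift^[n] | pastUpTo m]) ω - ∫ ξ, f ξ ∂(plusMarginal μ)|
              ≤ D * (⨆ ξ, |f ξ|) * γ ^ ((n : ℤ) - (m : ℤ))) ∧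
      IsGibbs μ ∧ ν ≪ plusMarginal μ := by
  have hB := hG.nonempty
  obtain ⟨P, hP⟩ := hG.exists_stationary
  obtain ⟨μ, hμp, hμ⟩ := exists_measure_of_tendsto
    (tendsto_measureReal_shift_cylinderSet hν hP)
  have hplus : IsProbabilityMeasure (plusMarginal μ) := by
    rw [plusMarginal_eq]
    exact Measure.isProbabilityMeasure_map (measurable_restrictFrom 0).aemeasurable
  refine ⟨μ, hμp, measurePreserving_shiftZ hμ, ?_, hG.isGibbs hP hμ,
    hG.absolutelyContinuous hP hν (measureReal_plusMarginal hμ)⟩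
  obtain ⟨γ, hγ, hlim⟩ := hG.exists_transfer_limit
  refine ⟨γ, hγ, fun k => ?_⟩
  obtain ⟨D, hD0, hD⟩ := hlim (k + 1)
  -- `D` serves for `m ≤ n`. For `n < m` the factor `γ ^ (n - m)` is at least `1` and the trivial
  -- bound `2 * M` suffices.
  refine ⟨D + 2, fun n m f hf => ?_⟩
  choose base hbase using fun l : List B => exists_mem_cylinderSet l
  set F : List B → ℝ := fun l => f (base l) with hF
  have hfF : ∀ ω, f ω = F (history ω (k + 1)) := fun ω =>
    apply_eq_of_measurable_pastUpTo hf (by simpa [mem_cylinderSet] using (hbase (history ω (k + 1))).symm)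
  set M : ℝ := ⨆ ξ, |f ξ| with hM
  have hbdd : BddAbove (Set.range fun ξ => |f ξ|) := by
    obtain ⟨R, hR⟩ := exists_bound_comp_history F (k + 1)
    refine ⟨R, ?_⟩
    rintro _ ⟨ξ, rfl⟩
    simp only [hfF ξ]
    exact hR ξ
  have hfM : ∀ ξ, |f ξ| ≤ M := fun ξ => le_ciSup hbdd ξ
  have hM0 : 0 ≤ M := (abs_nonneg _).trans (hfM (base []))
  set h : List B → ℝ := fun x => F (x.take (k + 1)) with hh
  obtain ⟨L, hL⟩ := hD h M (fun w w' hw => by simp only [hh, hw]) (fun w => hfM _)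
  have hfh : ∀ n ω, (f ∘ shift^[n]) ω = h (history ω (n + (k + 1))) := fun n ω => by
    rw [Function.comp_apply, hfF, history_iterate_shift]
  -- Both numbers are the limit of the expectation of `f ∘ shift^[n]`: one through the transfer
  -- operator, the other through the convergence of cylinder probabilities.
  have hLint : L = ∫ ξ, f ξ ∂(plusMarginal μ) := by
    have h1 : Tendsto (fun n => ∫ ω, (f ∘ shift^[n]) ω ∂ν) atTop (𝓝 L) := by
      simp only [hfh]
      simp only [integral_history_eq_transfer hν]
      refine Tendsto.comp (g := fun n => (transfer G)^[n] h []) ?_ (tendsto_add_atTop_nat (k + 1))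
      rw [tendsto_iff_norm_sub_tendsto_zero]
      refine squeeze_zero (fun n => norm_nonneg _) (fun n => hL n []) ?_
      simpa using (tendsto_pow_atTop_nhds_zero_of_lt_one hγ.1.le hγ.2).const_mul (D * M)
    refine tendsto_nhds_unique h1 ?_
    have hint : ∀ n, ∫ ω, (f ∘ shift^[n]) ω ∂ν
        = ∑ l ∈ words B (k + 1), F l * ν.real (shift^[n] ⁻¹' cylinderSet l) := by
      intro n
      have hm : Measurable (shift^[n] : (ℕ → B) → ℕ → B) := measurable_shift.iterate n
      have := Measure.isProbabilityMeasure_map (μ := ν) hm.aemeasurable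
      have h2 := integral_comp_history (ν.map shift^[n]) F (k + 1)
      rw [integral_map hm.aemeasurable (measurable_comp_history F _).aestronglyMeasurable] at h2
      simp only [Function.comp_apply, hfF, h2]
      refine Finset.sum_congr rfl fun l _ => ?_
      rw [map_measureReal_apply hm (measurableSet_cylinderSet l)]
    simp only [hint]
    simp only [hfF]
    rw [integral_comp_history]
    refine tendsto_finsetSum _ fun l _ => ?_
    rw [measureReal_plusMarginal hμ]
    exact (tendsto_measureReal_shift_cylinderSet hν hP l).const_mul _
  rw [← hLint]
  have hfh' : f ∘ shift^[n] = fun ω => h (history ω (n + (k + 1))) := funext (hfh n)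
  rcases le_or_gt m n with hmn | hmn
  · obtain ⟨j, rfl⟩ := Nat.exists_eq_add_of_le hmn
    -- Here `f ∘ shift^[m + j]` reads the first `m + j + k + 1` letters, of which `m + 1` are known;
    -- `j + k` applications of the operator remain.
    have h1 := condExp_history_add hν h m (j + k)
    rw [hfh', show m + j + (k + 1) = m + 1 + (j + k) by ring]
    filter_upwards [h1] with ω hω
    rw [hω]
    refine (hL (j + k) _).trans ?_
    have h2 : ((m + j : ℕ) : ℤ) - m = (j : ℕ) := by push_cast; ring
    rw [h2, zpow_natCast, pow_add]
    have h3 : γ ^ k ≤ 1 := pow_le_one₀ hγ.1.le hγ.2.le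
    have h4 : 0 ≤ γ ^ j := pow_nonneg hγ.1.le _
    calc D * M * (γ ^ j * γ ^ k) ≤ D * M * (γ ^ j * 1) := by gcongr
      _ ≤ (D + 2) * M * γ ^ j := by rw [mul_one]; gcongr; linarith
  · have h1 : ∀ᵐ ω ∂ν, |(ν[f ∘ shift^[n] | pastUpTo m]) ω| ≤ M := by
      exact ae_bdd_abs_condExp_of_ae_bdd_abs (ae_of_all _ fun ω => hfM _)
    have h2 : |L| ≤ M := by
      rw [hLint]
      refine (norm_integral_le_of_norm_le_const (f := f) (C := M) (ae_of_all _ hfM)).trans_eq ?_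
      simp
    have h3 : 1 ≤ γ ^ ((n : ℤ) - m) := by
      obtain ⟨j, hj⟩ := Nat.exists_eq_add_of_lt hmn
      have h4 : (n : ℤ) - m = -((j + 1 : ℕ) : ℤ) := by omega
      rw [h4, zpow_neg, zpow_natCast]
      exact (one_le_inv₀ (pow_pos hγ.1 _)).2 (pow_le_one₀ hγ.1.le hγ.2.le)
    filter_upwards [h1] with ω hω
    calc _ ≤ M + M := (abs_sub _ _).trans (add_le_add hω h2)
      _ ≤ (D + 2) * M * 1 := by nlinarith
      _ ≤ _ := by gcongr

end Gibbs

/-! ### Contraction at a single site. -/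

section SiteLaw

variable {A : Type*} [Fintype A]

lemma exists_uniform_lower_bound {ι : Type*} [Finite ι] {f : ι → ℝ} (hf : ∀ i, 0 < f i) :
    ∃ c, 0 < c ∧ c < 1 ∧ ∀ i, c ≤ f i := by
  rcases isEmpty_or_nonempty ι with h | h
  · exact ⟨1 / 2, by norm_num, by norm_num, fun i => h.elim i⟩
  · obtain ⟨i₀, hi₀⟩ := Finite.exists_min f
    refine ⟨min (f i₀) (1 / 2), lt_min (hf i₀) (by norm_num),
      (min_le_right _ _).trans_lt (by norm_num), fun i => (min_le_left _ _).trans (hi₀ i)⟩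

lemma sum_toReal_pmf (κ : PMF A) : ∑ a, (κ a).toReal = 1 := by
  rw [← ENNReal.toReal_sum fun a _ => κ.apply_ne_top a, ← tsum_fintype (L := .unconditional A),
    κ.tsum_coe, ENNReal.toReal_one]

lemma toReal_pmf_bind (κ : PMF A) (p : A → PMF A) (b : A) :
    (κ.bind p b).toReal = ∑ a, (κ a).toReal * (p a b).toReal := by
  rw [PMF.bind_apply, tsum_fintype, ENNReal.toReal_sum fun a _ =>
    ENNReal.mul_ne_top (κ.apply_ne_top a) ((p a).apply_ne_top b)]
  simp only [ENNReal.toReal_mul]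

variable {p : A → PMF A} {c : ℝ}

lemma le_toReal_pmf_bind (hc : ∀ a b, c ≤ (p a b).toReal) (κ : PMF A) (b : A) :
    c ≤ (κ.bind p b).toReal := by
  rw [toReal_pmf_bind]
  calc c = ∑ a, (κ a).toReal * c := by rw [← Finset.sum_mul, sum_toReal_pmf, one_mul]
    _ ≤ _ := Finset.sum_le_sum fun a _ => mul_le_mul_of_nonneg_left (hc a b) ENNReal.toReal_nonneg

/-- A strictly positive stochastic matrix contracts the total variation distance. -/
lemma sum_abs_pmf_bind_sub_bind_le (hc0 : 0 ≤ c) (hc : ∀ a b, c ≤ (p a b).toReal)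
    (κ κ' : PMF A) :
    ∑ b, |(κ.bind p b).toReal - (κ'.bind p b).toReal|
      ≤ (1 - c) * ∑ a, |(κ a).toReal - (κ' a).toReal| := by
  -- The difference of `κ` and `κ'` has total mass zero, so `c` may be subtracted from every entry
  -- of the matrix; the remaining entries are nonnegative.
  have h1 : ∀ b, (κ.bind p b).toReal - (κ'.bind p b).toReal
      = ∑ a, ((κ a).toReal - (κ' a).toReal) * ((p a b).toReal - c) := by
    intro b
    simp only [toReal_pmf_bind, mul_sub, sub_mul, Finset.sum_sub_distrib, ← Finset.sum_mul,
      sum_toReal_pmf]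
    ring
  calc ∑ b, |(κ.bind p b).toReal - (κ'.bind p b).toReal|
      ≤ ∑ b, ∑ a, |(κ a).toReal - (κ' a).toReal| * ((p a b).toReal - c) := by
        refine Finset.sum_le_sum fun b _ => ?_
        rw [h1]
        refine (Finset.abs_sum_le_sum_abs _ _).trans_eq (Finset.sum_congr rfl fun a _ => ?_)
        rw [abs_mul, abs_of_nonneg (sub_nonneg.2 (hc a b))]
    _ = ∑ a, |(κ a).toReal - (κ' a).toReal| * (1 - Fintype.card A * c) := by
        rw [Finset.sum_comm]
        refine Finset.sum_congr rfl fun a _ => ?_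
        rw [← Finset.mul_sum, Finset.sum_sub_distrib, sum_toReal_pmf]
        simp
    _ ≤ ∑ a, |(κ a).toReal - (κ' a).toReal| * (1 - c) := by
        refine Finset.sum_le_sum fun a _ => mul_le_mul_of_nonneg_left ?_ (abs_nonneg _)
        have : (1 : ℝ) ≤ Fintype.card A := by
          exact_mod_cast Fintype.card_pos_iff.2 ⟨a⟩
        nlinarith
    _ = _ := by rw [← Finset.sum_mul, mul_comm]

end SiteLaw

/-! ### The transition probabilities of the local environment. -/

section Kernel

variable {d : ℕ} {A : Type*} {Λ : Finset (Site d)} {q : A → PMF Λ}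

/-- The conditional law, given the history `w`, of the state at the site with position `r`
relative to the walker. -/
noncomputable def siteLaw (p : A → PMF A) (π : PMF A) : List (Alphabet q) → Site d → PMF A
  | [], _ => π
  | b :: w, r =>
    if r + (b.1.2 : Site d) = 0 then p b.1.1 else (siteLaw p π w (r + (b.1.2 : Site d))).bind p

/-- The conditional probability of the letter `b` given the history `w`. -/
noncomputable def letterProb (p : A → PMF A) (π : PMF A) (b : Alphabet q) (w : List (Alphabet q)) :
    ENNReal :=
  siteLaw p π w 0 b.1.1 * q b.1.1 b.1.2

lemma letterProb_ne_top (p : A → PMF A) (π : PMF A) (b : Alphabet q) (w : List (Alphabet q)) :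
    letterProb p π b w ≠ ⊤ :=
  ENNReal.mul_ne_top (PMF.apply_ne_top _ _) (PMF.apply_ne_top _ _)

/-- Pairs outside the alphabet have `q = 0`, so the sum may run over all of `A × Λ`, where it
factors. -/
lemma tsum_letterProb (p : A → PMF A) (π : PMF A) (w : List (Alphabet q)) :
    ∑' b, letterProb p π b w = 1 := by
  have h := tsum_subtype_eq_of_support_subset
    (f := fun b : A × Λ => siteLaw p π w 0 b.1 * q b.1 b.2) (s := {b : A × Λ | 0 < q b.1 b.2})
    (fun b hb => pos_iff_ne_zero.2 (right_ne_zero_of_mul hb))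
  have h' : ∑' b, letterProb p π b w = ∑' b : A × Λ, siteLaw p π w 0 b.1 * q b.1 b.2 := h
  rw [h', ENNReal.tsum_prod']
  simp only [ENNReal.tsum_mul_left, PMF.tsum_coe, mul_one]

lemma siteLaw_pos {p : A → PMF A} (hp : ∀ a b, 0 < p a b) {π : PMF A} (hπ : π.bind p = π)
    (w : List (Alphabet q)) (r : Site d) (a : A) : 0 < siteLaw p π w r a := by
  have hbind : ∀ κ : PMF A, 0 < κ.bind p a := by
    intro κ
    obtain ⟨x, hx⟩ := κ.support_nonempty
    rw [pos_iff_ne_zero, ← PMF.mem_support_iff, PMF.mem_support_bind_iff]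
    exact ⟨x, hx, (PMF.mem_support_iff _ _).2 (hp x a).ne'⟩
  cases w with
  | nil => rw [siteLaw, ← hπ]; exact hbind π
  | cons b w =>
    rw [siteLaw]
    split_ifs
    · exact hp _ _
    · exact hbind _

variable [Fintype A]

lemma le_siteLaw {p : A → PMF A} {c : ℝ} (hc : ∀ a b, c ≤ (p a b).toReal) {π : PMF A}
    (hπ : π.bind p = π) (w : List (Alphabet q)) (r : Site d) (a : A) :
    c ≤ (siteLaw p π w r a).toReal := by
  cases w with
  | nil => rw [siteLaw, ← hπ]; exact le_toReal_pmf_bind hc _ _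
  | cons b w =>
    rw [siteLaw]
    split_ifs
    · exact hc _ _
    · exact le_toReal_pmf_bind hc _ _

/-- If the site was occupied during the `k` common steps, its last observed state and the time since
then are the same for both words and the laws coincide. Otherwise it evolved unobserved through
those steps, and each of them contracts the difference, at most `2` initially, by `1 - c`. -/
lemma sum_abs_siteLaw_sub_le {p : A → PMF A} {c : ℝ} (hc0 : 0 < c) (hc1 : c < 1)
    (hc : ∀ a b, c ≤ (p a b).toReal) (π : PMF A) (k : ℕ) (w w' : List (Alphabet q))
    (hw : w.take k = w'.take k) (r : Site d) :
    ∑ a, |(siteLaw p π w r a).toReal - (siteLaw p π w' r a).toReal| ≤ 2 * (1 - c) ^ k := by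
  induction k generalizing w w' r with
  | zero =>
    calc _ ≤ ∑ a, ((siteLaw p π w r a).toReal + (siteLaw p π w' r a).toReal) :=
          Finset.sum_le_sum fun a _ => (abs_sub _ _).trans_eq (by
            rw [abs_of_nonneg ENNReal.toReal_nonneg, abs_of_nonneg ENNReal.toReal_nonneg])
      _ = _ := by rw [Finset.sum_add_distrib, sum_toReal_pmf, sum_toReal_pmf]; norm_num
  | succ k ih =>
    have h0 : 0 ≤ 2 * (1 - c) ^ (k + 1) := by
      have : 0 ≤ 1 - c := by linarith
      positivity
    cases w with
    | nil =>
      cases w' with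
      | nil => simpa using h0
      | cons b' w' => simp at hw
    | cons b w =>
      cases w' with
      | nil => simp at hw
      | cons b' w' =>
        simp only [List.take_succ_cons, List.cons.injEq] at hw
        obtain ⟨rfl, hw⟩ := hw
        rw [siteLaw, siteLaw]
        split_ifs
        · simpa using h0
        · refine (sum_abs_pmf_bind_sub_bind_le hc0.le hc _ _).trans ?_
          rw [pow_succ]
          have := ih w w' hw (r + (b.1.2 : Site d))
          nlinarith

/-- The transition probabilities of the local environment form a Hölder kernel. -/
theorem exists_holderKernel_letterProb [Fintype (Alphabet q)] {p : A → PMF A}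
    (hp : ∀ a b, 0 < p a b) {π : PMF A} (hπ : π.bind p = π) :
    ∃ c C θ, HolderKernel
      (fun (b : Alphabet q) (w : List (Alphabet q)) => (letterProb p π b w).toReal) c C θ := by
  obtain ⟨c, hc0, hc1, hc⟩ := exists_uniform_lower_bound
    (f := fun x : A × A => (p x.1 x.2).toReal)
    (fun x => ENNReal.toReal_pos (hp _ _).ne' (PMF.apply_ne_top _ _))
  obtain ⟨c', hc0', hc1', hc'⟩ := exists_uniform_lower_bound
    (f := fun b : Alphabet q => (q b.1.1 b.1.2).toReal)
    (fun b => ENNReal.toReal_pos b.2.ne' (PMF.apply_ne_top _ _))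
  replace hc : ∀ a b, c ≤ (p a b).toReal := fun a b => hc (a, b)
  -- A site law is bounded below by the least entry of `p`, a jump by the least positive value of
  -- `q`. The rate `1 - c` is the contraction of one unobserved step.
  refine ⟨c * c', 2, 1 - c, ?_⟩
  constructor
  · positivity
  · nlinarith
  · norm_num
  · linarith
  · linarith
  · intro w
    rw [← ENNReal.toReal_sum fun b _ => letterProb_ne_top p π b w,
      ← tsum_fintype (L := .unconditional _), tsum_letterProb, ENNReal.toReal_one]
  · intro b w
    rw [letterProb, ENNReal.toReal_mul]
    exact mul_le_mul (le_siteLaw hc hπ w 0 _) (hc' b) hc0'.le ENNReal.toReal_nonneg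
  · intro k w w' hw b
    rw [letterProb, letterProb, ENNReal.toReal_mul, ENNReal.toReal_mul, ← sub_mul, abs_mul,
      abs_of_nonneg (a := (q b.1.1 b.1.2).toReal) ENNReal.toReal_nonneg]
    have h1 := sum_abs_siteLaw_sub_le hc0 hc1 hc π k w w' hw 0
    have h2 := Finset.single_le_sum
      (f := fun a => |(siteLaw p π w 0 a).toReal - (siteLaw p π w' 0 a).toReal|)
      (fun a _ => abs_nonneg _) (Finset.mem_univ b.1.1)
    have h3 : (q b.1.1 b.1.2).toReal ≤ 1 :=
      ENNReal.toReal_le_of_le_ofReal zero_le_one (by simpa using PMF.coe_le_one _ _)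
    calc _ ≤ |(siteLaw p π w 0 b.1.1).toReal - (siteLaw p π w' 0 b.1.1).toReal| * 1 := by gcongr
      _ ≤ _ := by rw [mul_one]; exact h2.trans h1

end Kernel

/-! ### One step of the environment and of the walker. -/

section Environment

lemma measurable_stateAtWalker {d : ℕ} {A : Type*} [MeasurableSpace A] :
    Measurable fun z : State d A => z.1 z.2 :=
  measurable_from_prod_countable_left fun s => measurable_pi_apply s

lemma measurable_localHistory {d : ℕ} {A : Type*} [MeasurableSpace A] :
    Measurable (localHistory : (ℕ → State d A) → ℕ → A × Site d) := by
  refine measurable_pi_lambda _ fun n => Measurable.prodMk ?_ ?_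
  · exact measurable_stateAtWalker.comp (measurable_pi_apply n)
  · exact (measurable_snd.comp (measurable_pi_apply _)).sub
      (measurable_snd.comp (measurable_pi_apply _))

variable {d : ℕ} {A : Type*} [Finite A] [MeasurableSpace A] [MeasurableSingletonClass A]

lemma lintegral_pmf (κ : PMF A) (f : A → ENNReal) :
    ∫⁻ a, f a ∂κ.toMeasure = ∑' a, κ a * f a := by
  rw [lintegral_countable']
  refine tsum_congr fun a => ?_
  rw [PMF.toMeasure_apply_singleton _ _ (measurableSet_singleton a), mul_comm]

lemma lintegral_infinitePi_prod (κ : Site d → PMF A) (F : Finset (Site d))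
    (g : Site d → A → ENNReal) :
    ∫⁻ x, ∏ u ∈ F, g u (x u) ∂(Measure.infinitePi fun u => (κ u).toMeasure)
      = ∏ u ∈ F, ∫⁻ a, g u a ∂(κ u).toMeasure := by
  have hg : ∀ u, Measurable (g u) := fun u => measurable_of_countable _
  rw [lintegral_prod_eq_prod_lintegral_of_indepFun F (fun u (x : Site d → A) => g u (x u))
    (iIndepFun_infinitePi hg) fun u => (hg u).comp (measurable_pi_apply u)]
  exact Finset.prod_congr rfl fun u _ =>
    (measurePreserving_eval_infinitePi (fun u => (κ u).toMeasure) u).lintegral_comp (hg u)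

/-- One step of the environment, restricted to the event that the site `s` is in the state `a`,
when the sites are independent. -/
lemma setLIntegral_envStep (p : A → PMF A) (κ : Site d → PMF A) (s : Site d) {a : A}
    (ha : κ s a ≠ 0) {E : Set (Site d → A)} (hE : MeasurableSet E) :
    ∫⁻ x in {x | x s = a}, envStep p x E ∂(Measure.infinitePi fun u => (κ u).toMeasure)
      = κ s a * Measure.infinitePi
          (fun u => (if u = s then p a else (κ u).bind p).toMeasure) E := by
  have : DecidableEq A := Classical.decEq A
  set ρ := Measure.infinitePi fun u => (κ u).toMeasure with hρ
  have hs : MeasurableSet {x : Site d → A | x s = a} :=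
    (measurable_pi_apply (X := fun _ : Site d => A) s) (measurableSet_singleton a)
  set N : Measure (Site d → A) := (ρ.restrict {x | x s = a}).bind (envStep p) with hN
  have hNapply : ∀ E, MeasurableSet E → N E = ∫⁻ x in {x | x s = a}, envStep p x E ∂ρ :=
    fun E hE => Measure.bind_apply hE (envStep p).measurable.aemeasurable
  have hbox : ∀ (F : Finset (Site d)) (t : Site d → Set A), (∀ u, MeasurableSet (t u)) →
      N (Set.pi F t) = κ s a * ∏ u ∈ F,
        (if u = s then p a else (κ u).bind p).toMeasure (t u) := by
    intro F t ht
    set k : Site d → A → ENNReal := fun u y => if u ∈ F then (p y).toMeasure (t u) else 1 with hk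
    -- For a box, the indicator of `x s = a` and the transition probabilities multiply to a product
    -- over finitely many sites, so independence evaluates the integral site by site: at `s` the
    -- state is fixed to `a`, elsewhere averaging gives `(κ u).bind p`.
    set g : Site d → A → ENNReal := fun u y =>
      (if u = s then (if y = a then 1 else 0) else 1) * k u y with hg
    have h1 : N (Set.pi F t) = ∫⁻ x, ∏ u ∈ insert s F, g u (x u) ∂ρ := by
      rw [hNapply _ (MeasurableSet.pi (Set.to_countable _) fun u _ => ht u),
        ← lintegral_indicator hs]
      refine lintegral_congr fun x => ?_
      have h2 : envStep p x (Set.pi F t) = ∏ u ∈ insert s F, k u (x u) := by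
        simp only [hk]
        rw [Finset.prod_ite_mem, Finset.inter_eq_right.2 (Finset.subset_insert s F)]
        exact Measure.infinitePi_pi _ fun u _ => ht u
      simp only [hg, Finset.prod_mul_distrib]
      rw [← h2, Finset.prod_ite_eq' (insert s F) s fun u => if x u = a then (1 : ENNReal) else 0,
        if_pos (Finset.mem_insert_self s F)]
      by_cases hx : x s = a
      · simp [hx]
      · simp [hx]
    have h3 : ∀ u, ∫⁻ y, g u y ∂(κ u).toMeasure = (if u = s then κ s a else 1) *
        (if u ∈ F then (if u = s then p a else (κ u).bind p).toMeasure (t u) else 1) := by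
      intro u
      rw [lintegral_pmf]
      by_cases hu : u = s
      · subst hu
        rw [tsum_eq_single a]
        · simp [hg, hk]
        · intro y hy
          simp [hg, hy]
      · simp only [hg, hk, hu, if_false, one_mul]
        by_cases huF : u ∈ F
        · simp only [huF, if_true]
          rw [PMF.toMeasure_bind_apply _ _ _ (ht u)]
        · simp only [huF, if_false, mul_one]
          exact PMF.tsum_coe _
    rw [h1, hρ, lintegral_infinitePi_prod]
    simp only [h3, Finset.prod_mul_distrib]
    rw [Finset.prod_ite_eq' (insert s F) s fun _ => κ s a, if_pos (Finset.mem_insert_self s F),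
      Finset.prod_ite_mem, Finset.inter_eq_right.2 (Finset.subset_insert s F)]
  have hne : κ s a ≠ ⊤ := (κ s).apply_ne_top a
  have hNeq : (κ s a)⁻¹ • N = Measure.infinitePi
      (fun u => (if u = s then p a else (κ u).bind p).toMeasure) := by
    refine Measure.eq_infinitePi _ fun F t ht => ?_
    rw [Measure.smul_apply, hbox F t ht, smul_eq_mul, ← mul_assoc, ENNReal.inv_mul_cancel ha hne,
      one_mul]
  rw [← hNapply E hE, ← hNeq, Measure.smul_apply, smul_eq_mul, ← mul_assoc,
    ENNReal.mul_inv_cancel ha hne, one_mul]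

variable {Λ : Finset (Site d)}

lemma walkStep_apply_add (q : A → PMF Λ) (x : Site d → A) (s : Site d) (v : Λ) :
    walkStep q (x, s) {s + (v : Site d)} = q (x s) v := by
  change ((q (x s)).map fun v : Λ => s + (v : Site d)).toMeasure {s + (v : Site d)} = _
  rw [PMF.toMeasure_apply_singleton _ _ (measurableSet_singleton _), PMF.map_apply,
    tsum_eq_single v]
  · simp
  · intro v' hv'
    rw [if_neg]
    intro h
    exact hv' (Subtype.ext (add_left_cancel h).symm)

lemma walkStep_apply_of_notMem (q : A → PMF Λ) (x : Site d → A) (s v : Site d) (hv : v ∉ Λ) :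
    walkStep q (x, s) {s + v} = 0 := by
  change ((q (x s)).map fun v : Λ => s + (v : Site d)).toMeasure {s + v} = _
  rw [PMF.toMeasure_apply_singleton _ _ (measurableSet_singleton _), PMF.map_apply]
  refine ENNReal.tsum_eq_zero.2 fun v' => ?_
  rw [if_neg]
  intro h
  exact hv ((add_left_cancel h) ▸ v'.2)

lemma jointStep_apply_prod (p : A → PMF A) (q : A → PMF Λ) (z : State d A)
    (E : Set (Site d → A)) (F : Set (Site d)) :
    jointStep p q z (E ×ˢ F) = envStep p z.1 E * walkStep q z F := by
  unfold jointStep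
  rw [Kernel.prod_apply_prod, Kernel.comap_apply]

end Environment

/-! ### Trajectories with a prescribed history. -/

section HistoryEvent

variable {d : ℕ} {A : Type*} {Λ : Finset (Site d)} {q : A → PMF Λ}

/-- The letter of the alphabet as a pair of a state and a jump. -/
def letterPair (b : Alphabet q) : A × Site d := (b.1.1, (b.1.2 : Site d))

lemma letterPair_injective : Function.Injective (letterPair : Alphabet q → A × Site d) := by
  rintro ⟨⟨a, v⟩, h⟩ ⟨⟨a', v'⟩, h'⟩ heq
  simp only [letterPair, Prod.mk.injEq] at heq
  obtain ⟨rfl, hv⟩ := heq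
  obtain rfl := Subtype.ext hv
  rfl

/-- The position of the walker after the history `w`. -/
def position (w : List (Alphabet q)) : Site d := (w.map fun b => (b.1.2 : Site d)).sum

/-- The trajectories that start at the origin and have the history `w`. -/
def historyEvent (w : List (Alphabet q)) : Set (ℕ → State d A) :=
  {z | (z 0).2 = 0 ∧ localHistory z ∈ cylinderSet (w.map letterPair)}

lemma historyEvent_cons (b : Alphabet q) (w : List (Alphabet q)) :
    historyEvent (b :: w) = historyEvent w ∩
      {z | localHistory z w.length = letterPair b} := by
  ext z
  simp only [historyEvent, List.map_cons, cylinderSet_cons, List.length_map, Set.mem_ofPred_eq,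
    Set.mem_inter_iff, and_assoc]

lemma snd_eq_position {w : List (Alphabet q)} {z : ℕ → State d A} (hz : z ∈ historyEvent w) :
    (z w.length).2 = position w := by
  induction w with
  | nil => exact hz.1
  | cons b w ih =>
    rw [historyEvent_cons] at hz
    have h1 := ih hz.1
    have h2 := congrArg Prod.snd hz.2
    simp only [localHistory, letterPair] at h2
    rw [List.length_cons, position, List.map_cons, List.sum_cons, ← position, ← h1, ← h2]
    abel

lemma historyEvent_dependsOn {w : List (Alphabet q)} {z z' : ℕ → State d A}
    (h : ∀ i ≤ w.length, z i = z' i) (hz : z ∈ historyEvent w) : z' ∈ historyEvent w := by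
  refine ⟨by rw [← h 0 (Nat.zero_le _)]; exact hz.1, ?_⟩
  have h2 := hz.2
  rw [mem_cylinderSet] at h2 ⊢
  refine Eq.trans ?_ h2
  rw [List.length_map, history_eq_history_iff]
  intro i hi
  simp only [localHistory, h i hi.le, h (i + 1) hi]

/-- The history fixes the walker's position, so the new letter splits into a condition on the
present state and one on the next state, the form required by the Markov property. -/
lemma historyEvent_cons_inter (b : Alphabet q) (w : List (Alphabet q))
    (E : Set (Site d → A)) :
    historyEvent (b :: w) ∩ {z | (z (w.length + 1)).1 ∈ E} =
      (historyEvent w ∩ {z | (z w.length).1 (position w) = b.1.1}) ∩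
        {z | z (w.length + 1) ∈ E ×ˢ {position w + (b.1.2 : Site d)}} := by
  ext z
  rw [historyEvent_cons]
  constructor
  · rintro ⟨⟨hz, hb⟩, hE⟩
    have hpos := snd_eq_position hz
    simp only [localHistory, letterPair, Set.mem_ofPred_eq, Prod.mk.injEq, hpos] at hb
    exact ⟨⟨hz, hb.1⟩, hE, by rw [Set.mem_singleton_iff, ← hb.2]; abel⟩
  · rintro ⟨⟨hz, hb⟩, hE, hs⟩
    have hpos := snd_eq_position hz
    rw [Set.mem_singleton_iff] at hs
    refine ⟨⟨hz, ?_⟩, hE⟩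
    simp only [localHistory, letterPair, Set.mem_ofPred_eq, Prod.mk.injEq, hpos, hs]
    exact ⟨hb, by abel⟩

lemma measurableSet_historyEvent [MeasurableSpace A] [MeasurableSingletonClass A]
    (w : List (Alphabet q)) :
    MeasurableSet (historyEvent w : Set (ℕ → State d A)) := by
  induction w with
  | nil =>
    have : historyEvent ([] : List (Alphabet q))
        = (fun z : ℕ → State d A => (z 0).2) ⁻¹' {0} := by
      ext z; simp [historyEvent, cylinderSet]
    rw [this]
    exact (measurable_snd.comp (measurable_pi_apply 0)) (measurableSet_singleton 0)
  | cons b w ih =>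
    rw [historyEvent_cons]
    exact ih.inter (((measurable_pi_apply _).comp measurable_localHistory)
      (measurableSet_singleton (letterPair b)))

end HistoryEvent

/-! ### Markov property and the environment given the history. -/

section JointProcess

variable {d : ℕ} {A : Type*} [Finite A] [MeasurableSpace A] [MeasurableSingletonClass A]
  {Λ : Finset (Site d)}

instance (p : A → PMF A) (π : PMF A) (q : A → PMF Λ) :
    IsProbabilityMeasure (processLaw p π q) := by
  unfold processLaw; infer_instance

lemma map_processLaw_zero (p : A → PMF A) (π : PMF A) (q : A → PMF Λ) :
    (processLaw p π q).map (fun z => z 0)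
      = (Measure.infinitePi (fun _ : Site d => π.toMeasure)).prod (Measure.dirac 0) := by
  have h1 : (fun z : ℕ → State d A => z 0) =
      (MeasurableEquiv.piUnique (fun _ : Finset.Iic 0 => State d A)) ∘
        Preorder.frestrictLe (π := fun _ => State d A) 0 := by
    funext z
    rfl
  rw [h1, ← Measure.map_map (MeasurableEquiv.measurable _) (by fun_prop), processLaw,
    Kernel.trajMeasure, Measure.map_comp _ _ (by fun_prop), Kernel.traj_map_frestrictLe,
    Kernel.partialTraj_self, Measure.id_comp, Measure.map_map (MeasurableEquiv.measurable _)
      (MeasurableEquiv.measurable _)]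
  exact (congrArg (fun g => Measure.map g _) (MeasurableEquiv.self_comp_symm _)).trans
    Measure.map_id

/-- The Markov property of the joint process. -/
lemma processLaw_inter_succ (p : A → PMF A) (π : PMF A) (q : A → PMF Λ) (n : ℕ)
    {H : Set (ℕ → State d A)} (hH : MeasurableSet H)
    (hdep : ∀ z z' : ℕ → State d A, (∀ i ≤ n, z i = z' i) → z ∈ H → z' ∈ H)
    {D : Set (State d A)} (hD : MeasurableSet D) :
    processLaw p π q (H ∩ {z | z (n + 1) ∈ D})
      = ∫⁻ z in H, jointStep p q (z n) D ∂(processLaw p π q) := by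
  -- Any extension of a finite trajectory would do, here one frozen after time `n`: `H` depends on
  -- the times up to `n` only, so it is the preimage of `e ⁻¹' H` under restriction.
  let e : (Finset.Iic n → State d A) → ℕ → State d A := fun y i =>
    if h : i ≤ n then y ⟨i, Finset.mem_Iic.2 h⟩ else y ⟨n, Finset.mem_Iic.2 le_rfl⟩
  have he : Measurable e := by
    refine measurable_pi_lambda _ fun i => ?_
    by_cases h : i ≤ n
    · simp only [e, h, dif_pos]; exact measurable_pi_apply _
    · simp only [e, h, dif_neg, not_false_eq_true]; exact measurable_pi_apply _
  have hr : Measurable (Preorder.frestrictLe (π := fun _ => State d A) n) := by fun_prop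
  have hpre : Preorder.frestrictLe (π := fun _ => State d A) n ⁻¹' (e ⁻¹' H) = H := by
    ext z
    have h1 : ∀ i ≤ n, e (Preorder.frestrictLe (π := fun _ => State d A) n z) i = z i := by
      intro i hi
      simp only [e, hi, dif_pos]
      rfl
    exact ⟨hdep _ _ h1, hdep _ _ fun i hi => (h1 i hi).symm⟩
  have key := congrArg (fun m => m ((e ⁻¹' H) ×ˢ D))
    (Kernel.map_frestrictLe_trajMeasure_compProd_eq_map_trajMeasure (X := fun _ => State d A)
      (μ₀ := (Measure.infinitePi (fun _ : Site d => π.toMeasure)).prod (Measure.dirac 0))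
      (κ := fun n => (jointStep p q).comap
        (fun h : (i : Finset.Iic n) → State d A => h ⟨n, Finset.mem_Iic.2 le_rfl⟩)
        (measurable_pi_apply _)) (a := n))
  rw [Measure.compProd_apply_prod (he hH) hD, Measure.map_apply (by fun_prop) ((he hH).prod hD),
    setLIntegral_map (he hH) (Kernel.measurable_coe _ hD) hr, hpre] at key
  simp only [Kernel.comap_apply] at key
  change ∫⁻ z in H, jointStep p q (z n) D ∂(processLaw p π q) = _ at key
  rw [key]
  change processLaw p π q _ = processLaw p π q _
  congr 1
  rw [Set.mk_preimage_prod]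
  congr 1
  exact hpre.symm

variable {q : A → PMF Λ}

/-- The probability of a history. -/
noncomputable def wordProb (p : A → PMF A) (π : PMF A) : List (Alphabet q) → ENNReal
  | [] => 1
  | b :: w => letterProb p π b w * wordProb p π w

/-- Given the history, the states at the different sites are independent with laws `siteLaw`. -/
theorem map_restrict_historyEvent {p : A → PMF A} (hp : ∀ a b, 0 < p a b) {π : PMF A}
    (hπ : π.bind p = π) (w : List (Alphabet q)) :
    ((processLaw p π q).restrict (historyEvent w)).map (fun z => (z w.length).1)
      = wordProb p π w • Measure.infinitePi
          (fun u => (siteLaw p π w (u - position w)).toMeasure) := by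
  have hm : ∀ n, Measurable fun z : ℕ → State d A => (z n).1 := fun n =>
    measurable_fst.comp (measurable_pi_apply n)
  induction w with
  | nil =>
    ext E hE
    rw [Measure.map_apply (hm _) hE, Measure.restrict_apply (hm _ hE), Measure.smul_apply]
    have h1 : (fun z : ℕ → State d A => (z ([] : List (Alphabet q)).length).1) ⁻¹' E ∩
        historyEvent ([] : List (Alphabet q)) = (fun z => z 0) ⁻¹' (E ×ˢ {0}) := by
      ext z; simp [historyEvent, cylinderSet]
    rw [h1, ← Measure.map_apply (measurable_pi_apply (X := fun _ : ℕ => State d A) 0) (hE.prod (measurableSet_singleton 0)),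
      map_processLaw_zero, Measure.prod_prod]
    simp [wordProb, siteLaw]
  | cons b w ih =>
    ext E hE
    rw [Measure.map_apply (hm _) hE, Measure.restrict_apply (hm _ hE), Measure.smul_apply,
      Set.inter_comm]
    have hsite : MeasurableSet {x : Site d → A | x (position w) = b.1.1} :=
      (measurable_pi_apply (X := fun _ : Site d => A) _) (measurableSet_singleton _)
    have h1 := historyEvent_cons_inter b w E
    have h2 := processLaw_inter_succ p π q w.length
      (H := historyEvent w ∩ {z | (z w.length).1 (position w) = b.1.1})
      ((measurableSet_historyEvent w).inter (hm w.length hsite))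
      (fun z z' h hz => ⟨historyEvent_dependsOn h hz.1, by
        rw [Set.mem_ofPred_eq, ← h w.length le_rfl]; exact hz.2⟩)
      (D := E ×ˢ {position w + (b.1.2 : Site d)}) (hE.prod (measurableSet_singleton _))
    have hpre : (fun z : ℕ → State d A => (z (b :: w).length).1) ⁻¹' E
        = {z | (z (w.length + 1)).1 ∈ E} := rfl
    rw [hpre, h1, h2]
    -- Given the present, jump and environment step are independent, and on this event the jump
    -- probability is the constant `q b.1.1 b.1.2`.
    have h3 : ∀ z ∈ historyEvent w ∩ {z | (z w.length).1 (position w) = b.1.1},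
        jointStep p q (z w.length) (E ×ˢ {position w + (b.1.2 : Site d)})
          = q b.1.1 b.1.2 * envStep p (z w.length).1 E := by
      rintro z ⟨hz, hb⟩
      have hz2 : z w.length = ((z w.length).1, position w) :=
        Prod.ext rfl (snd_eq_position hz)
      rw [jointStep_apply_prod, mul_comm]
      congr 1
      rw [hz2, walkStep_apply_add]
      exact congrArg (fun a => q a b.1.2) hb
    have hS : MeasurableSet
        (historyEvent w ∩ {z : ℕ → State d A | (z w.length).1 (position w) = b.1.1}) :=
      (measurableSet_historyEvent w).inter (hm w.length hsite)
    have hS' : MeasurableSet {z : ℕ → State d A | (z w.length).1 (position w) = b.1.1} :=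
      hm w.length hsite
    have hmeas : Measurable fun z : ℕ → State d A => envStep p (z w.length).1 E :=
      (Kernel.measurable_coe _ hE).comp (hm _)
    rw [setLIntegral_congr_fun hS h3,
      lintegral_const_mul _ hmeas, Set.inter_comm,
      ← Measure.restrict_restrict hS']
    have h4 := setLIntegral_map (μ := (processLaw p π q).restrict (historyEvent w)) hsite
      (f := fun x => envStep p x E) (Kernel.measurable_coe _ hE) (hm w.length)
    have h5 : (fun z : ℕ → State d A => (z w.length).1) ⁻¹' {x | x (position w) = b.1.1}
        = {z | (z w.length).1 (position w) = b.1.1} := rfl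
    rw [h5] at h4
    rw [← h4, ih, Measure.restrict_smul, lintegral_smul_measure,
      setLIntegral_envStep p (fun u => siteLaw p π w (u - position w)) (position w)
        (siteLaw_pos hp hπ _ _ _).ne' hE]
    -- Passing to the position after the jump shifts relative coordinates by `b.1.2`, exactly as in
    -- the recursion defining `siteLaw`.
    have h6 : (fun u => (if u = position w then p b.1.1
          else (siteLaw p π w (u - position w)).bind p).toMeasure)
        = fun u => (siteLaw p π (b :: w) (u - position (b :: w))).toMeasure := by
      funext u
      have h7 : u - position (b :: w) + (b.1.2 : Site d) = u - position w := by
        simp only [position, List.map_cons, List.sum_cons]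
        abel
      rw [siteLaw, h7]
      simp only [sub_eq_zero]
    rw [sub_self]
    rw [h6, wordProb, letterProb, smul_eq_mul, smul_eq_mul]
    ring

end JointProcess

lemma history_comp {B B' : Type*} (g : B → B') (ω : ℕ → B) (n : ℕ) :
    history (fun n => g (ω n)) n = (history ω n).map g := by
  induction n with
  | zero => rfl
  | succ n ih => rw [history_succ, history_succ, ih, List.map_cons]

/-! ### Cylinder probabilities of the history. -/

section HistoryLaw

variable {d : ℕ} {A : Type*} [Finite A] [MeasurableSpace A] [MeasurableSingletonClass A]
  {Λ : Finset (Site d)} {q : A → PMF Λ}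

lemma ae_start_eq_zero (p : A → PMF A) (π : PMF A) (q : A → PMF Λ) :
    ∀ᵐ z ∂processLaw p π q, (z 0).2 = 0 := by
  have h : ∀ᵐ y ∂(processLaw p π q).map (fun z => z 0), y.2 = 0 := by
    rw [map_processLaw_zero, ae_iff]
    have : {y : State d A | ¬ y.2 = 0} = Set.univ ×ˢ {0}ᶜ := by ext y; simp
    rw [this, Measure.prod_prod]
    simp
  exact ae_of_ae_map (measurable_pi_apply 0).aemeasurable h

lemma walkStep_eq_zero_of_notMem_range {x : Site d → A} {s v : Site d}
    (h : (x s, v) ∉ Set.range (letterPair : Alphabet q → A × Site d)) :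
    walkStep q (x, s) {s + v} = 0 := by
  by_cases hv : v ∈ Λ
  · have := walkStep_apply_add q x s ⟨v, hv⟩
    rw [this]
    by_contra hne
    exact h ⟨⟨(x s, ⟨v, hv⟩), pos_iff_ne_zero.2 hne⟩, rfl⟩
  · exact walkStep_apply_of_notMem q x s v hv

/-- A letter outside the alphabet requires a jump of probability zero, and there are only countably
many positions and pairs to exclude. Thus pulling the law back to sequences over the alphabet loses
no mass. -/
lemma ae_localHistory_mem_range (p : A → PMF A) (π : PMF A) (q : A → PMF Λ) :
    ∀ᵐ z ∂processLaw p π q, ∀ n,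
      localHistory z n ∈ Set.range (letterPair : Alphabet q → A × Site d) := by
  refine ae_all_iff.2 fun n => ?_
  rw [ae_iff]
  have hle : {z : ℕ → State d A | localHistory z n ∉
      Set.range (letterPair : Alphabet q → A × Site d)} ⊆
      ⋃ (s : Site d) (b : A × Site d) (_ : b ∉ Set.range (letterPair : Alphabet q → A × Site d)),
        {z | (z n).2 = s ∧ (z n).1 s = b.1} ∩
          {z | z (n + 1) ∈ (Set.univ : Set (Site d → A)) ×ˢ {s + b.2}} := by
    intro z hz
    simp only [Set.mem_iUnion]
    refine ⟨(z n).2, localHistory z n, hz, ⟨rfl, rfl⟩, Set.mem_univ _, ?_⟩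
    simp [localHistory]
  refine measure_mono_null hle ?_
  refine measure_iUnion_null fun s => measure_iUnion_null fun b => measure_iUnion_null fun hb => ?_
  have hH : MeasurableSet {z : ℕ → State d A | (z n).2 = s ∧ (z n).1 s = b.1} := by
    have h1 : Measurable fun z : ℕ → State d A => (z n).2 :=
      measurable_snd.comp (measurable_pi_apply n)
    have h2 : Measurable fun z : ℕ → State d A => (z n).1 s :=
      (measurable_pi_apply s).comp (measurable_fst.comp (measurable_pi_apply n))
    exact (h1 (measurableSet_singleton s)).inter (h2 (measurableSet_singleton b.1))
  rw [processLaw_inter_succ p π q n hH (fun z z' h hz => by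
    rw [Set.mem_ofPred_eq, ← h n le_rfl]; exact hz)
    (MeasurableSet.univ.prod (measurableSet_singleton _))]
  refine (setLIntegral_congr_fun (g := fun _ => 0) hH ?_).trans (by simp)
  rintro z ⟨hs, ha⟩
  have hz : z n = ((z n).1, s) := Prod.ext rfl hs
  simp only
  rw [jointStep_apply_prod, hz, walkStep_eq_zero_of_notMem_range, mul_zero]
  rwa [ha]

lemma measurableEmbedding_letterPair :
    MeasurableEmbedding (fun (ω : ℕ → Alphabet q) n => letterPair (ω n)) := by
  refine Measurable.measurableEmbedding ?_ ?_
  · exact measurable_pi_lambda _ fun n =>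
      (measurable_of_countable letterPair).comp (measurable_pi_apply n)
  · intro ω ω' h
    funext n
    exact letterPair_injective (congrFun h n)

lemma historyLaw_apply (p : A → PMF A) (π : PMF A) {E : Set (ℕ → Alphabet q)}
    (hE : MeasurableSet E) :
    historyLaw p π q E = processLaw p π q
      (localHistory ⁻¹' ((fun (ω : ℕ → Alphabet q) n => letterPair (ω n)) '' E)) := by
  have h1 := measurableEmbedding_letterPair (q := q)
  have h2 : historyLaw p π q E = ((processLaw p π q).map localHistory)
      ((fun (ω : ℕ → Alphabet q) n => letterPair (ω n)) '' E) := h1.comap_apply _ _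
  rw [h2, Measure.map_apply measurable_localHistory (h1.measurableSet_image.2 hE)]

lemma historyLaw_cylinderSet {p : A → PMF A} (hp : ∀ a b, 0 < p a b) {π : PMF A}
    (hπ : π.bind p = π) (w : List (Alphabet q)) :
    historyLaw p π q (cylinderSet w) = wordProb p π w := by
  have h1 : processLaw p π q (historyEvent w) = wordProb p π w := by
    have := congrArg (fun m => m Set.univ) (map_restrict_historyEvent (q := q) hp hπ w)
    simp only [Measure.smul_apply, measure_univ, smul_eq_mul, mul_one] at this
    have hm : Measurable fun z : ℕ → State d A => (z w.length).1 :=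
      measurable_fst.comp (measurable_pi_apply _)
    rwa [Measure.map_apply hm MeasurableSet.univ,
      Set.preimage_univ, Measure.restrict_apply_univ] at this
  rw [historyLaw_apply p π (measurableSet_cylinderSet w), ← h1]
  -- The two events agree for trajectories starting at the origin with all letters in the alphabet,
  -- that is, almost surely.
  refine measure_congr ?_
  filter_upwards [ae_start_eq_zero p π q, ae_localHistory_mem_range p π q] with z h0 hz
  refine propext ⟨?_, ?_⟩
  · rintro ⟨ω, hω, h⟩
    refine ⟨h0, ?_⟩
    rw [mem_cylinderSet] at hω ⊢
    rw [← h, history_comp, List.length_map, hω]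
  · rintro ⟨-, h⟩
    choose ω hω using hz
    have hω' : (fun n => letterPair (ω n)) = localHistory z := funext hω
    refine ⟨ω, ?_, hω'⟩
    rw [← hω', mem_cylinderSet, history_comp, List.length_map] at h
    exact List.map_injective_iff.2 letterPair_injective h

end HistoryLaw

end LocalEnv

/-! ### The lemma, from the Hölder kernel of the history. -/

theorem lemma3p1 {d : ℕ} {A : Type*} [Finite A] [MeasurableSpace A] [MeasurableSingletonClass A]
    (p : A → PMF A) (hp : ∀ a b, 0 < p a b)
    (π : PMF A) (hπ : π.bind p = π)
    (Λ : Finset (Fin d → ℤ)) (q : A → PMF Λ) :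
    ∃ μ : Measure (ℤ → LocalEnv.Alphabet q),
      IsProbabilityMeasure μ ∧ MeasurePreserving LocalEnv.shiftZ μ μ ∧
      (∃ γ ∈ Set.Ioo (0 : ℝ) 1, ∀ k : ℕ, ∃ C : ℝ, ∀ n m : ℕ,
        ∀ f : (ℕ → LocalEnv.Alphabet q) → ℝ, Measurable[LocalEnv.pastUpTo k] f →
          ∀ᵐ ω ∂(LocalEnv.historyLaw p π q),
            |((LocalEnv.historyLaw p π q)[f ∘ LocalEnv.shift^[n] | LocalEnv.pastUpTo m]) ω
                - ∫ ξ, f ξ ∂(LocalEnv.plusMarginal μ)|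
              ≤ C * (⨆ ξ, |f ξ|) * γ ^ ((n : ℤ) - (m : ℤ))) ∧
      LocalEnv.IsGibbs μ ∧
      (LocalEnv.historyLaw p π q) ≪ LocalEnv.plusMarginal μ := by
  have := Fintype.ofFinite A
  have := Fintype.ofFinite (LocalEnv.Alphabet q)
  obtain ⟨c, C, θ, hG⟩ := LocalEnv.exists_holderKernel_letterProb (q := q) hp hπ
  have hprob : IsProbabilityMeasure (LocalEnv.historyLaw p π q) := ⟨by
    rw [← LocalEnv.cylinderSet_nil, LocalEnv.historyLaw_cylinderSet hp hπ, LocalEnv.wordProb]⟩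
  refine hG.exists_isGibbs (LocalEnv.historyLaw p π q) fun b l => ?_
  simp only [measureReal_def, LocalEnv.historyLaw_cylinderSet hp hπ, LocalEnv.wordProb,
    ENNReal.toReal_mul]
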